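/- All Hilbert spaces are finite-dimensional and nonzero, with fixed computational bases. Let $N\ge 1$ and $\mathcal N=\{1,\dots,N\}$. **Routed graphs.** A routed graph is a finite directed graph (arrows may be open-ended at one end) in which every arrow $A$ carries a nonempty finite set $\mathrm{Ind}_A$ of index values and every node $\mathbf N$ a relation (route) $\lambda_{\mathbf N}$ from the lists of values on its incoming arrows to the lists of values on its outgoing arrows. A relation is *branched* if the image sets of any two inputs are equal or disjoint; its *branches* are the pairs of nonempty sets $(K^\beta,L^\beta)$ with $\lambda(k)=L^\beta$ for all $k\in K^\beta$ and $\lambda^\top(l)=K^\beta$ for all $l\in L^\beta$. The *augmented* route takes in addition a choice $l^\beta\in L^\beta$ for every branch, and sends an input $k\in K^{\bar\beta}$ to $(l^{\bar\beta},\bar\beta)$ (branch $\bar\beta$ *happens*). The graph is *univocal* if its routes are branched, its open-ended arrows carry a single value, and the composition of all augmented routes along the arrows is a function from choices to happening branches; it is *bi-univocal* if also its adjoint (arrows and routes reversed) is univocal. Let certain index values be declared one-dimensional. The *branch graph* has the branches of all nodes as vertices, and three kinds of arrows: a solid arrow $\mathbf N^\beta\to\mathbf M^\gamma$ if there is an arrow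 $A:\mathbf N\to\mathbf M$ such that the set of values of $A$ in assignments to all arrows that satisfy all routes and whose restrictions to the outgoing arrows of $\mathbf N$ and the incoming arrows of $\mathbf M$ lie in the output set of $\mathbf N^\beta$ and the input set of $\mathbf M^\gamma$ contains a value that is not one-dimensional, or more than one value; a green arrow if whether $\mathbf M^\gamma$ happens depends on the choice $l^{\mathbf N^\beta}$; a red arrow if in the adjoint graph whether $\mathbf N^\beta$ happens depends on the choice in $\mathbf M^\gamma$. The routed graph is *valid* if it is bi-univocal and every directed cycle of its branch graph consists only of green or only of red arrows. **The graph $\mathcal G_{\mathrm{QC\text{-}QC}(N)}$.** Its nodes are $\mathbf A_k$ ($k\in\mathcal N$) and $\mathbf V_{n+1}$ ($0\le n\le N$). There are an arrow from nowhere into $\mathbf V_1$ and an arrow from $\mathbf V_{N+1}$ to nowhere, each with one value, and for all $n,k\in\mathcal N$ arrows $\mathbf V_n\to\mathbf A_k$ and $\mathbf A_k\to\mathbf V_{n+1}$ with values $\mathcal X_n^k$, resp. $\mathcal X_n^{k\,\prime}$, each of which is either an $n$-element set $\mathcal K_n$ with $k\in \mathcal K_n\subseteq\mathcal N$ or a null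 value $\varnothing$. Route of $\mathbf A_k$: $\mathcal X_n^{k\,\prime}=\mathcal X_n^{k}$ for all $n$, and exactly one $\mathcal X_n^k$ is non-null. Route of $\mathbf V_{n+1}$ (dropping primes): exactly one incoming $\mathcal X_n^k$ is non-null (if $n\ge1$), exactly one outgoing $\mathcal X_{n+1}^\ell$ is non-null (if $n\le N-1$), and for these $\mathcal X_{n+1}^\ell=\mathcal X_n^k\cup\{\ell\}$ (if $1\le n\le N-1$). The null value on the internal arrows is the only one-dimensional index value. **Skeletal supermap.** Given a dimension for every index value, each arrow $A$ becomes $\mathcal H^A=\bigoplus_{k_A\in\mathrm{Ind}_A}\mathcal H^A_{k_A}$ and each node a slot for linear maps between the tensor products over its incoming and outgoing arrows that follow its route (vanish between unrelated sectors); plugged-in maps are contracted along the arrows. *Fleshing out* means filling each node with such a map, or with a supermap having such maps as outputs. A *routed isometry* (*unitary*) follows the route and is isometric (unitary) on the practical spaces, i.e. the sums of the sectors related to something by the route. A one-slot *superunitary* into a node sends unitaries, with arbitrary ancillas, to routed unitaries. **QC-QCs.** Let $\mathcal H^P,\mathcal H^F,\mathcal H^{A^I},\mathcal H^{A^O}$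 (all agents having isomorphic input spaces and isomorphic output spaces) and ancillas $\mathcal H^{\alpha_1},\dots,\mathcal H^{\alpha_N}$ be given. A (pure) $N$-slot QC-QC consists of operators $V_{\emptyset,\emptyset}^{\to\ell}:\mathcal H^P\to\mathcal H^{A^I\alpha_1}$, $V_{\mathcal K_n\setminus k,k}^{\to\ell}:\mathcal H^{A^O\alpha_n}\to\mathcal H^{A^I\alpha_{n+1}}$ ($1\le n<N$, $|\mathcal K_n|=n$, $k\in\mathcal K_n$, $\ell\notin\mathcal K_n$) and $V_{\mathcal N\setminus k,k}^{\to F}:\mathcal H^{A^O\alpha_N}\to\mathcal H^F$ such that $$\tilde V_1=\sum_\ell V_{\emptyset,\emptyset}^{\to\ell}\otimes|\emptyset,\ell\rangle,\quad \tilde V_{n+1}=\sum_{\mathcal K_n,k,\ell}V_{\mathcal K_n\setminus k,k}^{\to\ell}\otimes|\mathcal K_n,\ell\rangle\langle\mathcal K_n\setminus k,k|,\quad \tilde V_{N+1}=\sum_kV_{\mathcal N\setminus k,k}^{\to F}\otimes\langle\mathcal N\setminus k,k|$$ are isometries, the control spaces being spanned by the orthonormal states $|\mathcal K_n\setminus k,k\rangle$.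 Its process vector is $$|w_{\mathrm{QC\text{-}QC}}\rangle=\sum_{(k_1,\dots,k_N)}|V_{\emptyset,\emptyset}^{\to k_1}\rangle\!\rangle*|V_{\emptyset,k_1}^{\to k_2}\rangle\!\rangle*\cdots*|V_{\{k_1,\dots,k_{N-1}\},k_N}^{\to F}\rangle\!\rangle,$$ the sum being over all permutations of $\mathcal N$, $|\cdot\rangle\!\rangle$ being Choi vectors, and $*$ the link product, i.e. contraction over the common systems $\alpha_n$ (the input and output of the agent $k_n$ stay open); it acts on agents' operations by $(A_k)_k\mapsto(\bigotimes_k|A_k\rangle\!\rangle)*|w_{\mathrm{QC\text{-}QC}}\rangle$. Given a splitting $\mathcal H^F=\mathcal H^{F'}\otimes\mathcal H^{\alpha_F}$, the mixed QC-QC has the process matrix $W=\mathrm{Tr}_{\alpha_F}|w_{\mathrm{QC\text{-}QC}}\rangle\langle w_{\mathrm{QC\text{-}QC}}|$. **Theorem 4.1.** Let $N\ge1$. 1. $\mathcal G_{\mathrm{QC\text{-}QC}(N)}$ is bi-univocal and its branch graph has no directed cycles; in particular it is valid. 2. Take the skeletal supermap with null sectors $\mathbb C$, past and future spaces $\mathcal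 H^P,\mathcal H^F$, and sectors $\mathcal H^{\mathbf V_n\to\mathbf A_k}_{\mathcal K_n}=\mathcal H^{A^I}\otimes\mathcal H^{\alpha_n}$ and $\mathcal H^{\mathbf A_k\to\mathbf V_{n+1}}_{\mathcal K_n}=\mathcal H^{A^O}\otimes\mathcal H^{\alpha_n}$. Fill $\mathbf A_k$ with the one-slot supermap $A\mapsto J^{\mathrm{out}}_{\mathbf A_k}(A\otimes\mathbb 1)J^{\mathrm{in}}_{\mathbf A_k}$ and $\mathbf V_{n+1}$ with $J^{\mathrm{out}}_{\mathbf V_{n+1}}\tilde V_{n+1}J^{\mathrm{in}}_{\mathbf V_{n+1}}$, where the $J$'s are the canonical identifications of the practical spaces with $\mathcal H^{A^{I/O}}\otimes\bigoplus_n\bigoplus_{\mathcal K_n\ni k}\mathcal H^{\alpha_n}\otimes\mathbb C|\mathcal K_n\setminus k,k\rangle$, respectively with the spaces between which $\tilde V_{n+1}$ acts. Then the fillings of the $\mathbf A_k$, which do not depend on the QC-QC but only on the spaces, are superunitaries, and for every pure $N$-slot QC-QC on these spaces the fillings of the $\mathbf V_{n+1}$ are routed isometries, all fillings follow the routes, the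 resulting $N$-slot supermap is $(A_k)_k\mapsto(\bigotimes_k|A_k\rangle\!\rangle)*|w_{\mathrm{QC\text{-}QC}}\rangle$, and its process vector is $|w_{\mathrm{QC\text{-}QC}}\rangle$. 3. For every splitting $\mathcal H^F=\mathcal H^{F'}\otimes\mathcal H^{\alpha_F}$, tracing out $\alpha_F$ from the fleshed-out supermap gives the mixed QC-QC: its process matrix is $W$, and for all completely positive maps of the agents, with Choi matrices $M_k$, the Choi matrix of the resulting map from $P$ to $F'$ is $(\bigotimes_kM_k)*W$. -/

import Mathlib

open scoped Matrix Kronecker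

noncomputable section

namespace RQC

/-! # Relations -/

section Relations

variable {K L : Type}

/-- A relation is branched if the image sets of any two inputs are equal or disjoint. -/
def IsBranched (r : K → L → Prop) : Prop :=
  ∀ k k' : K, {l | r k l} = {l | r k' l} ∨ Disjoint {l | r k l} {l | r k' l}

/-- A branch of a relation: nonempty sets of inputs and outputs such that every input of the
branch is related to exactly its outputs, and conversely. -/
@[ext]
structure Branch (r : K → L → Prop) where
  dom : Set K
  cod : Set L
  dom_nonempty : dom.Nonempty
  cod_nonempty : cod.Nonempty
  image_eq : ∀ k ∈ dom, {l | r k l} = cod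
  preimage_eq : ∀ l ∈ cod, {k | r k l} = dom

/-- A branch of a relation, seen as a branch of the converse relation. -/
def Branch.transpose {r : K → L → Prop} (b : Branch r) : Branch (fun l k => r k l) where
  dom := b.cod
  cod := b.dom
  dom_nonempty := b.cod_nonempty
  cod_nonempty := b.dom_nonempty
  image_eq := b.preimage_eq
  preimage_eq := b.image_eq

/-- The augmented relation: the input `k`, together with one bifurcation choice `c b` in the output
set of each branch `b`, is related to the output `l` and the branch `b` iff `k` lies in `b` and
`l` is the bifurcation choice made in `b`. -/
def Augmented (r : K → L → Prop) (k : K) (c : ∀ b : Branch r, b.cod) (l : L) (b : Branch r) :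
    Prop :=
  k ∈ b.dom ∧ l = c b

end Relations

/-! # Indexed graphs and routed graphs -/

/-- A finite directed graph whose arrows carry nonempty finite sets of index values. An arrow `a`
with `src a = none` comes from nowhere, one with `tgt a = none` goes nowhere. -/
structure IndexedGraph where
  Node : Type
  Arr : Type
  src : Arr → Option Node
  tgt : Arr → Option Node
  Ind : Arr → Type
  /-- no arrow is open-ended at both ends -/
  attached : ∀ a, src a ≠ none ∨ tgt a ≠ none
  /-- at most one arrow from a given node to a given node -/
  simple : ∀ a b, src a ≠ none → tgt a ≠ none → src a = src b → tgt a = tgt b → a = b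
  nodeFintype : Fintype Node
  nodeDecEq : DecidableEq Node
  arrFintype : Fintype Arr
  arrDecEq : DecidableEq Arr
  indFintype : ∀ a, Fintype (Ind a)
  indNonempty : ∀ a, Nonempty (Ind a)

attribute [instance] IndexedGraph.nodeFintype IndexedGraph.nodeDecEq IndexedGraph.arrFintype
  IndexedGraph.arrDecEq IndexedGraph.indFintype IndexedGraph.indNonempty

namespace IndexedGraph

variable (G : IndexedGraph)

/-- The arrows pointing to a node. -/
abbrev In (n : G.Node) : Type := {a : G.Arr // G.tgt a = some n}

/-- The arrows leaving from a node. -/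
abbrev Out (n : G.Node) : Type := {a : G.Arr // G.src a = some n}

/-- The arrows that come from nowhere. -/
abbrev OpenIn : Type := {a : G.Arr // G.src a = none}

/-- The arrows that go nowhere. -/
abbrev OpenOut : Type := {a : G.Arr // G.tgt a = none}

/-- Lists of input index values of a node. -/
abbrev InVal (n : G.Node) : Type := ∀ a : G.In n, G.Ind a.1

/-- Lists of output index values of a node. -/
abbrev OutVal (n : G.Node) : Type := ∀ a : G.Out n, G.Ind a.1

end IndexedGraph

/-- A routed graph: an indexed graph with a relation (the route) at every node. -/
structure RoutedGraph extends IndexedGraph where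
  route : ∀ n : Node, toIndexedGraph.InVal n → toIndexedGraph.OutVal n → Prop

namespace RoutedGraph

variable (G : RoutedGraph)

/-- The adjoint routed graph: arrows reversed, routes replaced by their converses. -/
def adjoint : RoutedGraph where
  Node := G.Node
  Arr := G.Arr
  src := G.tgt
  tgt := G.src
  Ind := G.Ind
  attached := fun a => (G.attached a).symm
  simple := fun a b h1 h2 h3 h4 => G.simple a b h2 h1 h4 h3
  nodeFintype := G.nodeFintype
  nodeDecEq := G.nodeDecEq
  arrFintype := G.arrFintype
  arrDecEq := G.arrDecEq
  indFintype := G.indFintype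
  indNonempty := G.indNonempty
  route := fun n y x => G.route n x y

/-- The branches of all nodes (the vertices of the branch graph). -/
abbrev BranchNode : Type := Σ n : G.Node, Branch (G.route n)

/-- A bifurcation choice for every branch of every node. -/
abbrev Choices : Type := ∀ (n : G.Node) (b : Branch (G.route n)), b.cod

/-- The choice relation: the composition of all the augmented relations along the internal arrows.
Inputs: the values `u` of the arrows that come from nowhere and the bifurcation choices `c`.
Outputs: the values `v` of the arrows that go nowhere and the branches `b` that happen. -/
def ChoiceRel (u : ∀ a : G.OpenIn, G.Ind a.1) (c : G.Choices)
    (v : ∀ a : G.OpenOut, G.Ind a.1) (b : ∀ n : G.Node, Branch (G.route n)) : Prop :=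
  ∃ x : ∀ a : G.Arr, G.Ind a,
    (∀ a : G.OpenIn, x a.1 = u a) ∧ (∀ a : G.OpenOut, x a.1 = v a) ∧
      ∀ n : G.Node,
        Augmented (G.route n) (fun a : G.In n => x a.1) (c n) (fun a : G.Out n => x a.1) (b n)

/-- Univocality: the routes are branched, the open-ended arrows carry a single index value, and the
choice relation is a function. -/
structure Univocal : Prop where
  branched : ∀ n, IsBranched (G.route n)
  openTrivial : ∀ a, G.src a = none ∨ G.tgt a = none → Subsingleton (G.Ind a)
  isFunction : ∀ (u : ∀ a : G.OpenIn, G.Ind a.1) (c : G.Choices),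
    ∃! w : (∀ a : G.OpenOut, G.Ind a.1) × (∀ n : G.Node, Branch (G.route n)),
      G.ChoiceRel u c w.1 w.2

/-- Bi-univocality: the graph and its adjoint are univocal. -/
def BiUnivocal : Prop := G.Univocal ∧ G.adjoint.Univocal

/-- The index values of the arrow `a` that link the branch `b` to the branch `g`. -/
def LinkVal (b g : G.BranchNode) (a : G.Arr) : Set (G.Ind a) :=
  {v | ∃ x : ∀ a : G.Arr, G.Ind a, x a = v ∧
    (∀ n, G.route n (fun a : G.In n => x a.1) (fun a : G.Out n => x a.1)) ∧
    (fun a : G.Out b.1 => x a.1) ∈ b.2.cod ∧ (fun a : G.In g.1 => x a.1) ∈ g.2.dom}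

/-- `b` is a strong parent of `g`, given the sets of one-dimensional index values. -/
def StrongParent (oneDim : ∀ a : G.Arr, Set (G.Ind a)) (b g : G.BranchNode) : Prop :=
  ∃ a : G.Arr, G.src a = some b.1 ∧ G.tgt a = some g.1 ∧
    ((∃ v ∈ G.LinkVal b g a, v ∉ oneDim a) ∨ (G.LinkVal b g a).Nontrivial)

/-- The branch `g` happens for the bifurcation choices `c` (in a univocal graph: the component at
the node of `g` of the value of the choice function at `c` is `g`). -/
def Happens (c : G.Choices) (g : G.BranchNode) : Prop :=
  ∃ u v b, G.ChoiceRel u c v b ∧ b g.1 = g.2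

/-- `b` is a weak parent of `g`: whether `g` happens depends on the bifurcation choice in `b`. -/
def WeakParent (b g : G.BranchNode) : Prop :=
  ∃ c c' : G.Choices, (∀ b' : G.BranchNode, b' ≠ b → c b'.1 b'.2 = c' b'.1 b'.2) ∧
    ¬ (G.Happens c g ↔ G.Happens c' g)

/-- A branch, seen as a branch of the adjoint graph. -/
def toAdjoint (b : G.BranchNode) : G.adjoint.BranchNode := ⟨b.1, b.2.transpose⟩

/-- The three kinds of arrows of a branch graph. -/
inductive ArrowColour
  | solid
  | green
  | red

/-- The arrows of the branch graph. -/
def BranchArrow (oneDim : ∀ a : G.Arr, Set (G.Ind a)) :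
    ArrowColour → G.BranchNode → G.BranchNode → Prop
  | .solid, b, g => G.StrongParent oneDim b g
  | .green, b, g => G.WeakParent b g
  | .red, b, g => G.adjoint.WeakParent (G.toAdjoint g) (G.toAdjoint b)

/-- A loop (directed cycle) of the branch graph, with `len + 1` vertices; the addition in
`Fin (len + 1)` is cyclic. -/
structure Loop (oneDim : ∀ a : G.Arr, Set (G.Ind a)) where
  len : ℕ
  vert : Fin (len + 1) → G.BranchNode
  colour : Fin (len + 1) → ArrowColour
  vert_injective : Function.Injective vert
  arrow : ∀ i, G.BranchArrow oneDim (colour i) (vert i) (vert (i + 1))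

/-- A loop is weak if all its arrows are green, or all its arrows are red. -/
def Loop.IsWeak {G : RoutedGraph} {oneDim : ∀ a : G.Arr, Set (G.Ind a)} (l : G.Loop oneDim) :
    Prop :=
  (∀ i, l.colour i = .green) ∨ (∀ i, l.colour i = .red)

/-- A routed graph with given one-dimensional index values is valid if it is bi-univocal and every
loop of its branch graph is weak. -/
def Valid (oneDim : ∀ a : G.Arr, Set (G.Ind a)) : Prop :=
  G.BiUnivocal ∧ ∀ l : G.Loop oneDim, l.IsWeak

end RoutedGraph

/-! # Linear maps, routed linear maps, supermaps

A finite-dimensional Hilbert space with its computational basis is given by the finite type of the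
basis labels; a linear map from the space with basis `X` to the space with basis `Y` is a matrix
`Matrix Y X ℂ`. -/

section Maps

/-- The matrix is an isometry. -/
def IsIsometry {X Y : Type} [Fintype Y] [DecidableEq X] (U : Matrix Y X ℂ) : Prop :=
  Uᴴ * U = 1

/-- The matrix is unitary (possibly between different spaces of the same dimension). -/
def IsUnitary {X Y : Type} [Fintype X] [Fintype Y] [DecidableEq X] [DecidableEq Y]
    (U : Matrix Y X ℂ) : Prop :=
  Uᴴ * U = 1 ∧ U * Uᴴ = 1

variable {K L X Y : Type}

/-- A linear map between sectorised spaces follows the route `r`. Here `secX x` is the label of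
the sector to which the basis vector `x` belongs, likewise `secY`. -/
def Follows (r : K → L → Prop) (secX : X → K) (secY : Y → L) (U : Matrix Y X ℂ) : Prop :=
  ∀ y x, ¬ r (secX x) (secY y) → U y x = 0

open Classical in
/-- The projector onto the practical input space of a route. -/
def pracIn (r : K → L → Prop) (secX : X → K) : Matrix X X ℂ :=
  Matrix.diagonal fun x => if ∃ l, r (secX x) l then 1 else 0

open Classical in
/-- The projector onto the practical output space of a route. -/
def pracOut (r : K → L → Prop) (secY : Y → L) : Matrix Y Y ℂ :=
  Matrix.diagonal fun y => if ∃ k, r k (secY y) then 1 else 0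

/-- A routed isometry: it follows the route and is an isometry on the practical input space (it
vanishes outside of it). -/
def IsRoutedIsometry [Fintype Y] (r : K → L → Prop) (secX : X → K) (secY : Y → L)
    (U : Matrix Y X ℂ) : Prop :=
  Follows r secX secY U ∧ Uᴴ * U = pracIn r secX

/-- A routed unitary: it follows the route and is unitary from the practical input space to the
practical output space. -/
def IsRoutedUnitary [Fintype X] [Fintype Y] (r : K → L → Prop) (secX : X → K) (secY : Y → L)
    (U : Matrix Y X ℂ) : Prop :=
  Follows r secX secY U ∧ Uᴴ * U = pracIn r secX ∧ U * Uᴴ = pracOut r secY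

variable {S : Type} {I O : S → Type}

/-- Plugging maps with ancillary input and output systems into the slots of a supermap `T` (which
acts as the identity on the ancillas). -/
def plugWithAncillas (T : (∀ s, Matrix (O s) (I s) ℂ) → Matrix Y X ℂ) {ancIn ancOut : S → Type}
    (U : ∀ s, Matrix (O s × ancOut s) (I s × ancIn s) ℂ) :
    Matrix (Y × ∀ s, ancOut s) (X × ∀ s, ancIn s) ℂ :=
  fun y x => T (fun s => Matrix.of fun o i => U s (o, y.2 s) (i, x.2 s)) y.1 x.1

/-- A supermap with unsectorised slots, whose output maps go between sectorised spaces, is a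
(routed) superunitary: for all (unsectorised) ancillas and all unitaries plugged into its slots,
the resulting map is a routed unitary for the route `r`. -/
def IsRoutedSuperunitary [Fintype S] [DecidableEq S] [∀ s, Fintype (I s)] [∀ s, Fintype (O s)]
    [∀ s, DecidableEq (I s)] [∀ s, DecidableEq (O s)] [Fintype X] [Fintype Y]
    (r : K → L → Prop) (secX : X → K) (secY : Y → L)
    (T : (∀ s, Matrix (O s) (I s) ℂ) → Matrix Y X ℂ) : Prop :=
  ∀ (ancIn ancOut : S → Type) [∀ s, Fintype (ancIn s)] [∀ s, Fintype (ancOut s)]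
    [∀ s, DecidableEq (ancIn s)] [∀ s, DecidableEq (ancOut s)]
    (U : ∀ s, Matrix (O s × ancOut s) (I s × ancIn s) ℂ), (∀ s, IsUnitary (U s)) →
      IsRoutedUnitary r (fun x : X × (∀ s, ancIn s) => secX x.1)
        (fun y : Y × (∀ s, ancOut s) => secY y.1) (plugWithAncillas T U)

end Maps

/-! # Skeletal supermaps and fleshing out -/

/-- A dimension assignment: a (computational basis of a) nonzero finite-dimensional sector for
each index value of each arrow. The dimension of the sector is the cardinality of its basis. -/
structure DimAssignment (G : IndexedGraph) where
  Sector : ∀ a : G.Arr, G.Ind a → Type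
  sectorFintype : ∀ a k, Fintype (Sector a k)
  sectorNonempty : ∀ a k, Nonempty (Sector a k)

attribute [instance] DimAssignment.sectorFintype DimAssignment.sectorNonempty

namespace DimAssignment

variable {G : IndexedGraph} (D : DimAssignment G)

/-- The dimension of a sector. -/
def dim (a : G.Arr) (k : G.Ind a) : ℕ := Fintype.card (D.Sector a k)

/-- Basis of the sectorised space of an arrow, the direct sum of its sectors. -/
abbrev Wire (a : G.Arr) : Type := Σ k : G.Ind a, D.Sector a k

/-- Basis of the (formal) input space of a node, the tensor product over its incoming arrows. -/
abbrev InBasis (n : G.Node) : Type := ∀ a : G.In n, D.Wire a.1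

/-- Basis of the (formal) output space of a node. -/
abbrev OutBasis (n : G.Node) : Type := ∀ a : G.Out n, D.Wire a.1

/-- Basis of the global past: the tensor product over the arrows that come from nowhere. -/
abbrev PastBasis : Type := ∀ a : G.OpenIn, D.Wire a.1

/-- Basis of the global future: the tensor product over the arrows that go nowhere. -/
abbrev FutureBasis : Type := ∀ a : G.OpenOut, D.Wire a.1

/-- The sector (list of index values) of a basis vector of the input space of a node. -/
def inSector (n : G.Node) (x : D.InBasis n) : G.InVal n := fun a => (x a).1

/-- The sector of a basis vector of the output space of a node. -/
def outSector (n : G.Node) (y : D.OutBasis n) : G.OutVal n := fun a => (y a).1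

open Classical in
/-- The skeletal supermap: the maps `U n` plugged into the nodes are composed along the arrows,
which are interpreted as identity channels, i.e. the matrices are contracted over a common basis
vector for each internal arrow. -/
def skeletal (U : ∀ n, Matrix (D.OutBasis n) (D.InBasis n) ℂ) :
    Matrix D.FutureBasis D.PastBasis ℂ :=
  fun f p => ∑ x : ∀ a, D.Wire a,
    if (∀ a : G.OpenIn, x a.1 = p a) ∧ (∀ a : G.OpenOut, x a.1 = f a) then
      ∏ n, U n (fun a => x a.1) (fun a => x a.1)
    else 0

end DimAssignment

/-- Data filling the nodes: at each node a supermap with any (finite) number of slots, a node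
without slots being filled with a linear map. -/
abbrev Filling {G : IndexedGraph} (D : DimAssignment G) (Slot : G.Node → Type)
    (I O : ∀ n, Slot n → Type) : Type :=
  ∀ n, MultilinearMap ℂ (fun s : Slot n => Matrix (O n s) (I n s) ℂ)
    (Matrix (D.OutBasis n) (D.InBasis n) ℂ)

/-- A filling is a fleshing out of the skeletal supermap of a routed graph if at each node the
resulting map follows the route of the node. -/
def IsFleshingOut {G : RoutedGraph} {D : DimAssignment G.toIndexedGraph} {Slot : G.Node → Type}
    {I O : ∀ n, Slot n → Type} (Φ : Filling D Slot I O) : Prop :=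
  ∀ n ops, Follows (G.route n) (D.inSector n) (D.outSector n) (Φ n ops)

/-- The supermap obtained by composing the skeletal supermap with a filling; it has all the slots
of all the nodes. -/
def fleshOut {G : IndexedGraph} {D : DimAssignment G} {Slot : G.Node → Type}
    {I O : ∀ n, Slot n → Type} (Φ : Filling D Slot I O)
    (ops : ∀ n (s : Slot n), Matrix (O n s) (I n s) ℂ) : Matrix D.FutureBasis D.PastBasis ℂ :=
  D.skeletal fun n => Φ n (ops n)

/-! # The generic routed graph

Agents are `k : Fin N`. The time slot `t : Fin N` stands for `n = t + 1`, so it ranges over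
`n = 1, …, N`. The node `V j`, `j : Fin (N + 1)`, is the one called `V_{j+1}`. -/

/-- The nodes: one node `A k` for each agent, and the internal nodes `V_1, …, V_{N+1}`. -/
inductive QNode (N : ℕ) : Type
  | A (k : Fin N)
  | V (j : Fin (N + 1))
  deriving DecidableEq, Fintype

/-- The arrows: `past` is the arrow into `V_1`, `future` the arrow out of `V_{N+1}`; for `n = t + 1`,
`toA t k` is the arrow `V_n → A_k` and `fromA t k` is the arrow `A_k → V_{n+1}`. -/
inductive QArr (N : ℕ) : Type
  | past
  | future
  | toA (t k : Fin N)
  | fromA (t k : Fin N)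
  deriving DecidableEq, Fintype

namespace QArr

variable {N : ℕ}

/-- The node an arrow leaves from. -/
def src : QArr N → Option (QNode N)
  | past => none
  | future => some (.V (Fin.last N))
  | toA t _ => some (.V t.castSucc)
  | fromA _ k => some (.A k)

/-- The node an arrow points to. -/
def tgt : QArr N → Option (QNode N)
  | past => some (.V 0)
  | future => none
  | toA _ k => some (.A k)
  | fromA t _ => some (.V t.succ)

/-- The non-null index values at time slot `t` and agent `k`: the subsets of the set of agents that
have `n = t + 1` elements and contain `k`. -/
abbrev Subs (t k : Fin N) : Type := {K : Finset (Fin N) // K.card = (t : ℕ) + 1 ∧ k ∈ K}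

/-- The index values: a single one for the open-ended arrows, and for the others a set in
`Subs t k` or the null value `none`. -/
def Ind : QArr N → Type
  | past => Unit
  | future => Unit
  | toA t k => Option (Subs t k)
  | fromA t k => Option (Subs t k)

instance instFintypeInd : ∀ a : QArr N, Fintype (Ind a)
  | past => inferInstanceAs (Fintype Unit)
  | future => inferInstanceAs (Fintype Unit)
  | toA t k => inferInstanceAs (Fintype (Option (Subs t k)))
  | fromA t k => inferInstanceAs (Fintype (Option (Subs t k)))

theorem nonemptyInd : ∀ a : QArr N, Nonempty (Ind a)
  | past => ⟨()⟩
  | future => ⟨()⟩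
  | toA _ _ => ⟨none⟩
  | fromA _ _ => ⟨none⟩

theorem attached : ∀ a : QArr N, src a ≠ none ∨ tgt a ≠ none
  | past => Or.inr (by simp [tgt])
  | future => Or.inl (by simp [src])
  | toA _ _ => Or.inl (by simp [src])
  | fromA _ _ => Or.inl (by simp [src])

theorem simple (a b : QArr N) (h1 : src a ≠ none) (h2 : tgt a ≠ none) (h3 : src a = src b)
    (h4 : tgt a = tgt b) : a = b := by
  cases a <;> cases b <;> simp_all [src, tgt]

end QArr

/-- The indexed graph underlying the generic routed graph. -/
def genericIndexed (N : ℕ) : IndexedGraph where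
  Node := QNode N
  Arr := QArr N
  src := QArr.src
  tgt := QArr.tgt
  Ind := QArr.Ind
  attached := QArr.attached
  simple := QArr.simple
  nodeFintype := inferInstance
  nodeDecEq := inferInstance
  arrFintype := inferInstance
  arrDecEq := inferInstance
  indFintype := inferInstance
  indNonempty := QArr.nonemptyInd

section Access

variable {N : ℕ}

/-- `V_n → A_k` (`n = t + 1`) as an arrow pointing to `A_k`. -/
abbrev inA (t k : Fin N) : (genericIndexed N).In (.A k) := ⟨.toA t k, rfl⟩

/-- `A_k → V_{n+1}` (`n = t + 1`) as an arrow leaving from `A_k`. -/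
abbrev outA (t k : Fin N) : (genericIndexed N).Out (.A k) := ⟨.fromA t k, rfl⟩

/-- `A_k → V_{n+1}` (`n = t + 1`) as an arrow pointing to `V_{n+1}`. -/
abbrev inV (t k : Fin N) : (genericIndexed N).In (.V t.succ) := ⟨.fromA t k, rfl⟩

/-- `V_n → A_k` (`n = t + 1`) as an arrow leaving from `V_n`. -/
abbrev outV (t k : Fin N) : (genericIndexed N).Out (.V t.castSucc) := ⟨.toA t k, rfl⟩

/-- The input index value `X_n^k` (`n = t + 1`) of the node `A_k`. -/
def inAVal {k : Fin N} (x : (genericIndexed N).InVal (.A k)) (t : Fin N) :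
    Option (QArr.Subs t k) := x (inA t k)

/-- The output index value `X_n^k` (`n = t + 1`) of the node `A_k`. -/
def outAVal {k : Fin N} (y : (genericIndexed N).OutVal (.A k)) (t : Fin N) :
    Option (QArr.Subs t k) := y (outA t k)

/-- The input index value `X_n^k` of the node `V_{n+1}`, where `n = t + 1`. -/
def inVVal {j : Fin (N + 1)} (x : (genericIndexed N).InVal (.V j)) (t : Fin N) (h : t.succ = j)
    (k : Fin N) : Option (QArr.Subs t k) :=
  x ⟨.fromA t k, by subst h; rfl⟩

/-- The output index value `X_n^k` of the node `V_n`, where `n = t + 1`. -/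
def outVVal {j : Fin (N + 1)} (y : (genericIndexed N).OutVal (.V j)) (t : Fin N)
    (h : t.castSucc = j) (k : Fin N) : Option (QArr.Subs t k) :=
  y ⟨.toA t k, by subst h; rfl⟩

end Access

/-- The routes. At `A_k` the input and output lists agree and have exactly one non-null entry. At
each internal node exactly one of the input values (if the inputs come from the agents) and
exactly one of the output values (if the outputs go to the agents) is non-null, and
if both kinds are present, then the non-null values `K` (at the position `k`) and `L` (at the
position `l`) satisfy `L = K ∪ {l}`. -/
def genericRoute (N : ℕ) : ∀ n : QNode N,
    (genericIndexed N).InVal n → (genericIndexed N).OutVal n → Prop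
  | .A _, x, y => (∀ t, inAVal x t = outAVal y t) ∧ ∃! t, inAVal x t ≠ none
  | .V j, x, y =>
      (∀ (s : Fin N) (hs : s.succ = j), ∃! k, inVVal x s hs k ≠ none) ∧
      (∀ (t : Fin N) (ht : t.castSucc = j), ∃! l, outVVal y t ht l ≠ none) ∧
      (∀ (s t : Fin N) (hs : s.succ = j) (ht : t.castSucc = j) (k l : Fin N)
        (K : QArr.Subs s k) (L : QArr.Subs t l),
        inVVal x s hs k = some K → outVVal y t ht l = some L → L.1 = insert l K.1)

/-- The generic routed graph for quantum circuits with quantum control of causal order with `N`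
slots. -/
def generic (N : ℕ) : RoutedGraph where
  toIndexedGraph := genericIndexed N
  route := genericRoute N

/-- The one-dimensional index values: the null value on the internal arrows. -/
def nullOneDim (N : ℕ) : ∀ a : (generic N).Arr, Set ((generic N).Ind a)
  | .past => ∅
  | .future => ∅
  | .toA t k => {(none : Option (QArr.Subs t k))}
  | .fromA t k => {(none : Option (QArr.Subs t k))}

/-! # Quantum circuits with quantum control of causal order

There are `N = m + 1` agents. -/

/-- (Computational bases of) the Hilbert spaces: the global past and future, the input and output
spaces of the agents (the same for all agents), and the ancillary spaces; `α t` is the ancillary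
space called `α_n`, for `n = t + 1`. -/
structure Spaces (m : ℕ) where
  P : Type
  F : Type
  AI : Type
  AO : Type
  α : Fin (m + 1) → Type
  fintypeP : Fintype P
  fintypeF : Fintype F
  fintypeAI : Fintype AI
  fintypeAO : Fintype AO
  fintypeα : ∀ t, Fintype (α t)
  decEqP : DecidableEq P
  decEqF : DecidableEq F
  decEqAI : DecidableEq AI
  decEqAO : DecidableEq AO
  decEqα : ∀ t, DecidableEq (α t)
  nonemptyP : Nonempty P
  nonemptyF : Nonempty F
  nonemptyAI : Nonempty AI
  nonemptyAO : Nonempty AO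
  nonemptyα : ∀ t, Nonempty (α t)

attribute [instance] Spaces.fintypeP Spaces.fintypeF Spaces.fintypeAI Spaces.fintypeAO
  Spaces.fintypeα Spaces.decEqP Spaces.decEqF Spaces.decEqAI Spaces.decEqAO Spaces.decEqα
  Spaces.nonemptyP Spaces.nonemptyF Spaces.nonemptyAI Spaces.nonemptyAO Spaces.nonemptyα

/-- The basis of the control system `C_n` (or its copy `C_n'`), `n = t + 1`: the pair `(K, k)` with
`k ∈ K`, `|K| = n`, labels the state `|K ∖ k, k⟩`. -/
abbrev Ctrl (N : ℕ) (t : Fin N) : Type :=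
  {c : Finset (Fin N) × Fin N // c.1.card = (t : ℕ) + 1 ∧ c.2 ∈ c.1}

/-- The internal operators: `first l` is `V_{∅,∅}^{→ l}`, `mid s K k l` is `V_{K ∖ k, k}^{→ l}` for
`|K| = n = s + 1`, `k ∈ K`, `l ∉ K` (other arguments are irrelevant), and `last k` is
`V_{𝒩 ∖ k, k}^{→ F}`. -/
structure InternalOps {m : ℕ} (S : Spaces m) where
  first : Fin (m + 1) → Matrix (S.AI × S.α 0) S.P ℂ
  mid : (s : Fin m) → Finset (Fin (m + 1)) → Fin (m + 1) → Fin (m + 1) →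
    Matrix (S.AI × S.α s.succ) (S.AO × S.α s.castSucc) ℂ
  last : Fin (m + 1) → Matrix S.F (S.AO × S.α (Fin.last m)) ℂ

namespace InternalOps

variable {m : ℕ} {S : Spaces m} (Q : InternalOps S)

/-- The joint internal operation `Ṽ_1`. -/
def tildeFirst : Matrix (S.AI × S.α 0 × Ctrl (m + 1) 0) S.P ℂ :=
  fun y p => Q.first y.2.2.1.2 (y.1, y.2.1) p

/-- The joint internal operation `Ṽ_{n+1}`, `n = s + 1`, which maps the control state
`|K ∖ k, k⟩` to states `|K, l⟩`, `l ∉ K`. -/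
def tildeMid (s : Fin m) :
    Matrix (S.AI × S.α s.succ × Ctrl (m + 1) s.succ)
      (S.AO × S.α s.castSucc × Ctrl (m + 1) s.castSucc) ℂ :=
  fun y x => if y.2.2.1.1 = insert y.2.2.1.2 x.2.2.1.1 then
    Q.mid s x.2.2.1.1 x.2.2.1.2 y.2.2.1.2 (y.1, y.2.1) (x.1, x.2.1) else 0

/-- The joint internal operation `Ṽ_{N+1}`. -/
def tildeLast : Matrix S.F (S.AO × S.α (Fin.last m) × Ctrl (m + 1) (Fin.last m)) ℂ :=
  fun f x => Q.last x.2.2.1.2 f (x.1, x.2.1)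

end InternalOps

/-- A (pure) quantum circuit with quantum control of causal order with `m + 1` slots: internal
operators such that the joint internal operations are isometries. -/
structure QCQC {m : ℕ} (S : Spaces m) extends InternalOps S where
  isometry_first : IsIsometry toInternalOps.tildeFirst
  isometry_mid : ∀ s, IsIsometry (toInternalOps.tildeMid s)
  isometry_last : IsIsometry toInternalOps.tildeLast

namespace QCQC

variable {m : ℕ} {S : Spaces m} (Q : QCQC S)

/-- For the order `σ` of the agents, the set of the agents in the first `n = t + 1` positions. -/
def visited (σ : Equiv.Perm (Fin (m + 1))) (t : Fin (m + 1)) : Finset (Fin (m + 1)) :=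
  (Finset.univ.filter fun s => s ≤ t).image σ

/-- The process vector `|w_{(k_1, …, k_N, F)}⟩` of an order `k_{t+1} = σ t` of the agents: the link
product (contraction over the ancillary spaces) of the Choi vectors of the internal operators.
The component at `p`, `i`, `o`, `f` is that on the basis vectors `p` of the past, `i k` and `o k` of
the input and output space of each agent `k`, and `f` of the future. -/
def orderVector (σ : Equiv.Perm (Fin (m + 1))) (p : S.P) (i : Fin (m + 1) → S.AI)
    (o : Fin (m + 1) → S.AO) (f : S.F) : ℂ :=
  ∑ a : ∀ t, S.α t,
    Q.first (σ 0) (i (σ 0), a 0) p *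
    (∏ s : Fin m, Q.mid s (visited σ s.castSucc) (σ s.castSucc) (σ s.succ)
      (i (σ s.succ), a s.succ) (o (σ s.castSucc), a s.castSucc)) *
    Q.last (σ (Fin.last m)) f (o (σ (Fin.last m)), a (Fin.last m))

/-- The process vector `|w_QC-QC⟩`: the sum over all orders of the agents. -/
def processVector (p : S.P) (i : Fin (m + 1) → S.AI) (o : Fin (m + 1) → S.AO) (f : S.F) : ℂ :=
  ∑ σ : Equiv.Perm (Fin (m + 1)), Q.orderVector σ p i o f

/-- The supermap defined by the circuit: the operations `A k` of the agents are sent to the map with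
Choi vector `(⊗_k |A_k⟩⟩) * |w_QC-QC⟩`. -/
def supermap (A : Fin (m + 1) → Matrix S.AO S.AI ℂ) : Matrix S.F S.P ℂ :=
  fun f p => ∑ i : Fin (m + 1) → S.AI, ∑ o : Fin (m + 1) → S.AO,
    (∏ k, A k (o k) (i k)) * Q.processVector p i o f

end QCQC

/-- The process vector (Choi vector) of a supermap with `m + 1` slots, given by its values on the
matrix units. -/
def processVectorOf {m : ℕ} {S : Spaces m}
    (T : (Fin (m + 1) → Matrix S.AO S.AI ℂ) → Matrix S.F S.P ℂ)
    (p : S.P) (i : Fin (m + 1) → S.AI) (o : Fin (m + 1) → S.AO) (f : S.F) : ℂ :=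
  T (fun k => Matrix.single (o k) (i k) 1) f p

/-- The process matrix `Tr_{αF} |w⟩⟨w|` of a process vector `w`, for a splitting `e` of the future
space as the tensor product of `F'` and `αF`. -/
def mixedProcessMatrix {m : ℕ} {S : Spaces m} {F' αF : Type} [Fintype αF] (e : S.F ≃ F' × αF)
    (w : S.P → (Fin (m + 1) → S.AI) → (Fin (m + 1) → S.AO) → S.F → ℂ) :
    Matrix (S.P × (Fin (m + 1) → S.AI) × (Fin (m + 1) → S.AO) × F')
      (S.P × (Fin (m + 1) → S.AI) × (Fin (m + 1) → S.AO) × F') ℂ :=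
  fun x y => ∑ a : αF, w x.1 x.2.1 x.2.2.1 (e.symm (x.2.2.2, a)) *
    star (w y.1 y.2.1 y.2.2.1 (e.symm (y.2.2.2, a)))

/-- The Choi matrix `∑_r |A_r⟩⟩⟨⟨A_r|` of the completely positive map with Kraus operators `A r`. -/
def choiMatrix {R X Y : Type} [Fintype R] (A : R → Matrix Y X ℂ) : Matrix (X × Y) (X × Y) ℂ :=
  fun x y => ∑ r, A r x.2 x.1 * star (A r y.2 y.1)

/-- The action of a process matrix `W` on the Choi matrices `M k` of the operations of the agents:
the link product `(⊗_k M k) * W`, which is the Choi matrix of the resulting map from `P` to `F'`. -/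
def mixedSupermap {m : ℕ} {S : Spaces m} {F' : Type}
    (W : Matrix (S.P × (Fin (m + 1) → S.AI) × (Fin (m + 1) → S.AO) × F')
      (S.P × (Fin (m + 1) → S.AI) × (Fin (m + 1) → S.AO) × F') ℂ)
    (M : Fin (m + 1) → Matrix (S.AI × S.AO) (S.AI × S.AO) ℂ) : Matrix (S.P × F') (S.P × F') ℂ :=
  fun x y => ∑ i : Fin (m + 1) → S.AI, ∑ o : Fin (m + 1) → S.AO,
    ∑ i' : Fin (m + 1) → S.AI, ∑ o' : Fin (m + 1) → S.AO,
      (∏ k, M k (i k, o k) (i' k, o' k)) * W (x.1, i, o, x.2) (y.1, i', o', y.2)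

/-- Kraus operators of the map that results from a supermap `T` when the agents perform the
completely positive maps with Kraus operators `A k r` and the part `αF` of the future is traced
out. -/
def discardKraus {m : ℕ} {S : Spaces m} {F' αF : Type} (e : S.F ≃ F' × αF)
    (T : (Fin (m + 1) → Matrix S.AO S.AI ℂ) → Matrix S.F S.P ℂ) {R : Fin (m + 1) → Type}
    (A : ∀ k, R k → Matrix S.AO S.AI ℂ) : (∀ k, R k) × αF → Matrix F' S.P ℂ :=
  fun r => Matrix.of fun f p => T (fun k => A k (r.1 k)) (e.symm (f, r.2)) p

/-! # The fleshing out of the generic skeletal supermap -/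

section FleshingOut

variable {m : ℕ} (S : Spaces m)

/-- The sectors: the past and the future, a one-dimensional space for the null values, and for
the other values at time slot `t` the agent's input (or output) space tensored with `α t`. -/
def sector : ∀ a : QArr (m + 1), QArr.Ind a → Type
  | .past, _ => S.P
  | .future, _ => S.F
  | .toA _ _, none => Unit
  | .toA t _, some _ => S.AI × S.α t
  | .fromA _ _, none => Unit
  | .fromA t _, some _ => S.AO × S.α t

instance instFintypeSector : ∀ (a : QArr (m + 1)) (k : QArr.Ind a), Fintype (sector S a k)
  | .past, _ => inferInstanceAs (Fintype S.P)
  | .future, _ => inferInstanceAs (Fintype S.F)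
  | .toA _ _, none => inferInstanceAs (Fintype Unit)
  | .toA t _, some _ => inferInstanceAs (Fintype (S.AI × S.α t))
  | .fromA _ _, none => inferInstanceAs (Fintype Unit)
  | .fromA t _, some _ => inferInstanceAs (Fintype (S.AO × S.α t))

instance instNonemptySector : ∀ (a : QArr (m + 1)) (k : QArr.Ind a), Nonempty (sector S a k)
  | .past, _ => inferInstanceAs (Nonempty S.P)
  | .future, _ => inferInstanceAs (Nonempty S.F)
  | .toA _ _, none => inferInstanceAs (Nonempty Unit)
  | .toA t _, some _ => inferInstanceAs (Nonempty (S.AI × S.α t))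
  | .fromA _ _, none => inferInstanceAs (Nonempty Unit)
  | .fromA t _, some _ => inferInstanceAs (Nonempty (S.AO × S.α t))

/-- The dimension assignment of the generic routed graph. -/
def dims : DimAssignment (generic (m + 1)).toIndexedGraph where
  Sector := sector S
  sectorFintype := instFintypeSector S
  sectorNonempty := instNonemptySector S

variable {S}

/-- The basis vector `(i, a)` of the sector `K` of the wire `V_n → A_k`, `n = t + 1`. -/
def toAVec {t k : Fin (m + 1)} (K : QArr.Subs t k) (i : S.AI) (a : S.α t) :
    (dims S).Wire (.toA t k) := ⟨(some K : Option (QArr.Subs t k)), ((i, a) : S.AI × S.α t)⟩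

/-- The basis vector `(o, a)` of the sector `K` of the wire `A_k → V_{n+1}`, `n = t + 1`. -/
def fromAVec {t k : Fin (m + 1)} (K : QArr.Subs t k) (o : S.AO) (a : S.α t) :
    (dims S).Wire (.fromA t k) := ⟨(some K : Option (QArr.Subs t k)), ((o, a) : S.AO × S.α t)⟩

/-- The basis vector of the null sector of `V_n → A_k`. -/
def toANull (t k : Fin (m + 1)) : (dims S).Wire (.toA t k) := ⟨(none : Option (QArr.Subs t k)), ()⟩

/-- The basis vector of the null sector of `A_k → V_{n+1}`. -/
def fromANull (t k : Fin (m + 1)) : (dims S).Wire (.fromA t k) :=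
  ⟨(none : Option (QArr.Subs t k)), ()⟩

/-- The basis vector `p` of the past wire. -/
def pastVec (p : S.P) : (dims S).Wire .past := ⟨(), p⟩

/-- The basis vector `f` of the future wire. -/
def futureVec (f : S.F) : (dims S).Wire .future := ⟨(), f⟩

variable (S)

open Classical in
/-- The identification of the practical input space of `V_{n+1}`, `n = t + 1`, with
`Ã_n^O ⊗ α_n ⊗ C_n'`: on the sector with `K` at the position `k` (null values elsewhere) it maps `ψ`
to `ψ ⊗ |K ∖ k, k⟩`. -/
def jInV (t : Fin (m + 1)) :
    Matrix (S.AO × S.α t × Ctrl (m + 1) t) ((dims S).InBasis (.V t.succ)) ℂ :=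
  fun z x => if x (inV t z.2.2.1.2) = fromAVec ⟨z.2.2.1.1, z.2.2.2⟩ z.1 z.2.1 ∧
    ∀ k', k' ≠ z.2.2.1.2 → x (inV t k') = fromANull t k' then 1 else 0

open Classical in
/-- The identification of `Ã_n^I ⊗ α_n ⊗ C_n`, `n = t + 1`, with the practical output space of
`V_n`: it maps `ψ ⊗ |K ∖ k, k⟩` to `ψ` in the sector with `K` at the position `k`. -/
def jOutV (t : Fin (m + 1)) :
    Matrix ((dims S).OutBasis (.V t.castSucc)) (S.AI × S.α t × Ctrl (m + 1) t) ℂ :=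
  fun y z => if y (outV t z.2.2.1.2) = toAVec ⟨z.2.2.1.1, z.2.2.2⟩ z.1 z.2.1 ∧
    ∀ k', k' ≠ z.2.2.1.2 → y (outV t k') = toANull t k' then 1 else 0

open Classical in
/-- The identification of the input space of `V_1` with the past. -/
def jInFirst : Matrix S.P ((dims S).InBasis (.V 0)) ℂ :=
  fun p x => if x ⟨.past, rfl⟩ = pastVec p then 1 else 0

open Classical in
/-- The identification of the future with the output space of `V_{N+1}`. -/
def jOutLast : Matrix ((dims S).OutBasis (.V (Fin.last (m + 1)))) S.F ℂ :=
  fun y f => if y ⟨.future, rfl⟩ = futureVec f then 1 else 0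

variable {S}

/-- The map filling the internal node `V j`: the internal isometry of the circuit, between the
identifications of the spaces. -/
def fillV (Q : QCQC S) (j : Fin (m + 2)) :
    Matrix ((dims S).OutBasis (.V j)) ((dims S).InBasis (.V j)) ℂ :=
  Fin.cases
    (motive := fun j => Matrix ((dims S).OutBasis (.V j)) ((dims S).InBasis (.V j)) ℂ)
    (jOutV S 0 * Q.tildeFirst * jInFirst S)
    (fun i => Fin.lastCases
      (motive := fun i : Fin (m + 1) =>
        Matrix ((dims S).OutBasis (.V i.succ)) ((dims S).InBasis (.V i.succ)) ℂ)
      (jOutLast S * Q.tildeLast * jInV S (Fin.last m))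
      (fun s => jOutV S s.succ * Q.tildeMid s * jInV S s.castSucc) i) j

variable (S)

/-- The basis of the practical part of the control and ancillary system of the agent `k`: the
direct sum over `n = t + 1` of `α_n ⊗ C_n^{(k)}`. -/
abbrev CtrlA (k : Fin (m + 1)) : Type := Σ t : Fin (m + 1), S.α t × QArr.Subs t k

open Classical in
/-- The identification of the practical input space of `A_k` with the agent's input space tensored
with the control and ancillary system. -/
def jInA (k : Fin (m + 1)) : Matrix (S.AI × CtrlA S k) ((dims S).InBasis (.A k)) ℂ :=
  fun z x => if x (inA z.2.1 k) = toAVec z.2.2.2 z.1 z.2.2.1 ∧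
    ∀ t', t' ≠ z.2.1 → x (inA t' k) = toANull t' k then 1 else 0

open Classical in
/-- The identification of the agent's output space tensored with the control and ancillary system
with the practical output space of `A_k`. -/
def jOutA (k : Fin (m + 1)) : Matrix ((dims S).OutBasis (.A k)) (S.AO × CtrlA S k) ℂ :=
  fun y z => if y (outA z.2.1 k) = fromAVec z.2.2.2 z.1 z.2.2.1 ∧
    ∀ t', t' ≠ z.2.1 → y (outA t' k) = fromANull t' k then 1 else 0

/-- The one-slot supermap filling the node `A_k`: the operation of the agent acts in parallel with
the identity on the control and ancillary system. It depends only on the spaces. -/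
def fillA (k : Fin (m + 1)) : Matrix S.AO S.AI ℂ →ₗ[ℂ]
    Matrix ((dims S).OutBasis (.A k)) ((dims S).InBasis (.A k)) ℂ where
  toFun A := jOutA S k * (A ⊗ₖ (1 : Matrix (CtrlA S k) (CtrlA S k) ℂ)) * jInA S k
  map_add' A B := by simp [Matrix.add_kronecker, Matrix.mul_add, Matrix.add_mul]
  map_smul' c A := by simp [Matrix.smul_kronecker]

/-- The slots that remain after the fleshing out: one at each `A`-node, none at the `V`-nodes. -/
def qSlot : QNode (m + 1) → Type
  | .A _ => Unit
  | .V _ => Empty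

variable {S}

/-- The operations of the agents, as a family indexed by the slots. -/
def slotOps (A : Fin (m + 1) → Matrix S.AO S.AI ℂ) :
    ∀ (n : QNode (m + 1)) (_ : qSlot n), Matrix S.AO S.AI ℂ
  | .A k, _ => A k
  | .V _, e => nomatch e

/-- The filling of all the nodes. -/
def filling (Q : QCQC S) :
    Filling (dims S) qSlot (fun _ _ => S.AI) (fun _ _ => S.AO)
  | .A k => (fillA S k).compMultilinearMap
      (MultilinearMap.ofSubsingleton ℂ (Matrix S.AO S.AI ℂ) (Matrix S.AO S.AI ℂ) ()
        LinearMap.id : MultilinearMap ℂ (fun _ : Unit => Matrix S.AO S.AI ℂ) _)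
  | .V j =>
      (MultilinearMap.constOfIsEmpty ℂ (fun _ : Empty => Matrix S.AO S.AI ℂ) (fillV Q j) :)

/-- The global past of the skeletal supermap is the space `P`. -/
def pastBasis (p : S.P) : (dims S).PastBasis
  | ⟨.past, _⟩ => pastVec p
  | ⟨.future, h⟩ => nomatch h
  | ⟨.toA _ _, h⟩ => nomatch h
  | ⟨.fromA _ _, h⟩ => nomatch h

/-- The global future of the skeletal supermap is the space `F`. -/
def futureBasis (f : S.F) : (dims S).FutureBasis
  | ⟨.past, h⟩ => nomatch h
  | ⟨.future, _⟩ => futureVec f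
  | ⟨.toA _ _, h⟩ => nomatch h
  | ⟨.fromA _ _, h⟩ => nomatch h

/-- The supermap obtained by fleshing out the skeletal supermap of the generic routed graph. -/
def fleshedOut (Q : QCQC S) (A : Fin (m + 1) → Matrix S.AO S.AI ℂ) : Matrix S.F S.P ℂ :=
  (fleshOut (filling Q) (slotOps A)).submatrix futureBasis pastBasis

end FleshingOut

end RQC

end

open RQC

/-!
Everything rests on one combinatorial fact: the assignments of index values to all the arrows that
satisfy all the routes correspond to the orders `σ` of the agents
(`IsConsistent.exists_eq_assign`). At time slot `t` the only non-null value is the set of the first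
`t + 1` agents of the order, and it stands at the position of the agent `σ t`.

*Validity.* A branch of an internal node is given by the set of the agents that have already
acted, and a bifurcation choice in it picks one of the remaining agents as the next one. Hence the
choices form a rule that builds exactly one order from its first agent to its last
(`choiceRel_iff`), and in the adjoint graph one that builds it from its last agent to its first
(`adjoint_choiceRel_iff`); the latter reduces to the former by reversing the order and
complementing the sets. Each branch has a time `branchTime`, and it increases along every arrow of
the branch graph: along solid arrows since non-null values travel forward in time, along green
arrows since the order up to a time depends only on earlier choices, and along red arrows
by the same argument backwards. So there are no loops at all.

*Fillings.* All the identifications of practical spaces send basis vectors injectively to basis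
vectors, so that each filling is a matrix placed in a block (`IsCorner`) that
the practical spaces single out. It is a routed isometry or unitary as soon as the matrix in the
block is one: for the internal nodes this is the isometry `Ṽ_n`, and for the agents `U ⊗ 1`,
up to reordering tensor factors.

*Contraction.* As all the fillings follow the routes, a nonzero term of the contraction along the
arrows comes from an order of the agents together with basis vectors of the agents' and ancillary
spaces (`exists_history`); its value is the product of the entries of the agents' operations with
the corresponding term of the process vector (`nodeProduct_wires`). This gives
`fleshedOut_eq_supermap`, and the claim on the mixed circuit follows by exchanging finite sums.
-/

namespace RQC

/-! ### Branches of relations made of disjoint blocks -/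

section BranchFamilies

variable {K L ι : Type} {r : K → L → Prop}

theorem Branch.rel_of_mem (b : Branch r) {k : K} {l : L} (hk : k ∈ b.dom) (hl : l ∈ b.cod) :
    r k l := by
  have h := b.image_eq k hk
  rw [← h] at hl
  exact hl

theorem Augmented.rel {k : K} {c : ∀ b : Branch r, b.cod} {l : L} {b : Branch r}
    (h : Augmented r k c l b) : r k l :=
  b.rel_of_mem h.1 (h.2 ▸ (c b).2)

theorem Branch.eq_of_mem_dom {b b' : Branch r} {k : K} (h : k ∈ b.dom) (h' : k ∈ b'.dom) :
    b = b' := by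
  have hc : b.cod = b'.cod := by rw [← b.image_eq k h, ← b'.image_eq k h']
  obtain ⟨l, hl⟩ := b.cod_nonempty
  have hd : b.dom = b'.dom := by rw [← b.preimage_eq l hl, ← b'.preimage_eq l (hc ▸ hl)]
  exact Branch.ext hd hc

/-- `r` relates `k` to `l` iff `k` and `l` belong to blocks of the same index, where the
blocks `p i` of inputs are disjoint, and so are the blocks `q i` of outputs. All blocks are
nonempty, so that the pairs `(p i, q i)` are exactly the branches of `r`. -/
structure BlockDecomposition (r : K → L → Prop) (p : ι → K → Prop) (q : ι → L → Prop) : Prop where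
  rel_iff : ∀ k l, r k l ↔ ∃ i, p i k ∧ q i l
  inj_left : ∀ i i' k, p i k → p i' k → i = i'
  inj_right : ∀ i i' l, q i l → q i' l → i = i'
  nonempty_left : ∀ i, ∃ k, p i k
  nonempty_right : ∀ i, ∃ l, q i l

namespace BlockDecomposition

variable {p : ι → K → Prop} {q : ι → L → Prop} (h : BlockDecomposition r p q)
include h

theorem transpose : BlockDecomposition (fun l k => r k l) q p where
  rel_iff l k := by simp only [h.rel_iff, and_comm]
  inj_left := h.inj_right
  inj_right := h.inj_left
  nonempty_left := h.nonempty_right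
  nonempty_right := h.nonempty_left

theorem isBranched : IsBranched r := by
  intro k k'
  by_contra! hc
  obtain ⟨h1, h2⟩ := hc
  rw [Set.not_disjoint_iff] at h2
  obtain ⟨l, hl, hl'⟩ := h2
  obtain ⟨i, hi, hil⟩ := (h.rel_iff _ _).1 hl
  obtain ⟨i', hi', hil'⟩ := (h.rel_iff _ _).1 hl'
  obtain rfl := h.inj_right _ _ _ hil hil'
  apply h1
  ext l'
  simp only [Set.mem_ofPred_eq, h.rel_iff]
  constructor
  · rintro ⟨j, hj, hj'⟩
    obtain rfl := h.inj_left _ _ _ hi hj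
    exact ⟨_, hi', hj'⟩
  · rintro ⟨j, hj, hj'⟩
    obtain rfl := h.inj_left _ _ _ hi' hj
    exact ⟨_, hi, hj'⟩

theorem exists_rel_iff (k : K) : (∃ l, r k l) ↔ ∃ i, p i k := by
  simp only [h.rel_iff]
  exact ⟨fun ⟨_, i, hi, _⟩ => ⟨i, hi⟩, fun ⟨i, hi⟩ => ⟨_, i, hi, (h.nonempty_right i).choose_spec⟩⟩

/-- The branch with index `i` of a relation with a block decomposition. -/
def branch (i : ι) : Branch r where
  dom := {k | p i k}
  cod := {l | q i l}
  dom_nonempty := h.nonempty_left i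
  cod_nonempty := h.nonempty_right i
  image_eq k hk := by
    ext l
    simp only [Set.mem_ofPred_eq, h.rel_iff]
    exact ⟨fun ⟨j, hj, hj'⟩ => h.inj_left _ _ _ hk hj ▸ hj', fun hl => ⟨i, hk, hl⟩⟩
  preimage_eq l hl := by
    ext k
    simp only [Set.mem_ofPred_eq, h.rel_iff]
    exact ⟨fun ⟨j, hj, hj'⟩ => h.inj_right _ _ _ hl hj' ▸ hj, fun hk => ⟨i, hk, hl⟩⟩

theorem exists_branch_eq (b : Branch r) : ∃ i, b = h.branch i := by
  obtain ⟨k, hk⟩ := b.dom_nonempty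
  obtain ⟨l, hl⟩ := b.cod_nonempty
  obtain ⟨i, hi, -⟩ := (h.rel_iff _ _).1 (b.rel_of_mem hk hl)
  exact ⟨i, Branch.eq_of_mem_dom hk hi⟩

end BlockDecomposition

end BranchFamilies

/-! ### Orders of the agents built by a rule -/

section Orders

variable {N : ℕ}

/-- The set of the agents that come before position `j` (excluded) in the order `σ`. -/
def before (σ : Equiv.Perm (Fin N)) (j : ℕ) : Finset (Fin N) :=
  Finset.univ.filter fun k => (σ.symm k : ℕ) < j

@[simp]
theorem mem_before {σ : Equiv.Perm (Fin N)} {j : ℕ} {k : Fin N} :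
    k ∈ before σ j ↔ (σ.symm k : ℕ) < j := by
  simp [before]

theorem card_before (σ : Equiv.Perm (Fin N)) {j : ℕ} (hj : j ≤ N) : (before σ j).card = j := by
  have : before σ j = (Finset.univ.filter fun k : Fin N => (k : ℕ) < j).map σ.toEmbedding := by
    ext k
    simp only [mem_before, Finset.mem_map, Finset.mem_filter, Finset.mem_univ, true_and,
      Equiv.coe_toEmbedding]
    exact ⟨fun h => ⟨_, h, by simp⟩, by rintro ⟨a, h, rfl⟩; simpa using h⟩
  rw [this, Finset.card_map, Fin.card_filter_val_lt]
  exact min_eq_right hj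

theorem before_succ (σ : Equiv.Perm (Fin N)) (t : Fin N) :
    before σ (t + 1) = insert (σ t) (before σ t) := by
  ext k
  simp only [mem_before, Finset.mem_insert, Nat.lt_succ_iff_lt_or_eq, ← Fin.ext_iff,
    Equiv.symm_apply_eq]
  tauto

theorem apply_mem_before (σ : Equiv.Perm (Fin N)) (t : Fin N) : σ t ∈ before σ (t + 1) := by simp

theorem before_congr {σ τ : Equiv.Perm (Fin N)} {j : ℕ}
    (h : ∀ t : Fin N, (t : ℕ) < j → σ t = τ t) : before σ j = before τ j := by
  ext k
  simp only [mem_before]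
  constructor
  · intro hk
    have := h _ hk
    rw [Equiv.apply_symm_apply] at this
    rwa [this, Equiv.symm_apply_apply]
  · intro hk
    have := h _ hk
    rw [Equiv.apply_symm_apply] at this
    rwa [← this, Equiv.symm_apply_apply]

/-- Positions from `j` on also determine the agents before `j`, as the complement of the rest. -/
theorem before_congr_of_ge {σ τ : Equiv.Perm (Fin N)} {j : ℕ}
    (h : ∀ t : Fin N, j ≤ (t : ℕ) → σ t = τ t) : before σ j = before τ j := by
  ext k
  simp only [mem_before]
  rw [← not_iff_not, not_lt, not_lt]
  constructor
  · intro hk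
    have := h _ hk
    rw [Equiv.apply_symm_apply] at this
    rwa [this, Equiv.symm_apply_apply]
  · intro hk
    have := h _ hk
    rw [Equiv.apply_symm_apply] at this
    rwa [← this, Equiv.symm_apply_apply]

/-- Two orders that are built by the rules `f` and `g`, each choosing the next agent as a function
of the set of the previous ones, agree up to the position up to which the rules do. -/
theorem order_eq_of_rules_eq {f g : Finset (Fin N) → Fin N} {σ τ : Equiv.Perm (Fin N)} {j : ℕ}
    (hσ : ∀ t, σ t = f (before σ t)) (hτ : ∀ t, τ t = g (before τ t))
    (h : ∀ K : Finset (Fin N), K.card < j → f K = g K) :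
    ∀ t : Fin N, (t : ℕ) < j → σ t = τ t := by
  suffices H : ∀ n : ℕ, ∀ t : Fin N, (t : ℕ) = n → n < j → σ t = τ t from fun t => H t t rfl
  intro n
  induction n using Nat.strong_induction_on with
  | _ n ih =>
    rintro t rfl hj
    have hb : before σ t = before τ t := before_congr fun s hs => ih s hs s rfl (hs.trans hj)
    rw [hσ, hτ, ← hb]
    exact h _ (by rwa [card_before σ t.2.le])

/-- A rule that always chooses an agent who has not acted yet builds an order. -/
theorem exists_order_of_rule {f : Finset (Fin N) → Fin N}
    (hf : ∀ K : Finset (Fin N), K.card < N → f K ∉ K) :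
    ∃ σ : Equiv.Perm (Fin N), ∀ t, σ t = f (before σ t) := by
  let K : ℕ → Finset (Fin N) := fun n => Nat.rec ∅ (fun _ K => insert (f K) K) n
  have hK : ∀ n, K (n + 1) = insert (f (K n)) (K n) := fun _ => rfl
  have hmono : Monotone K := monotone_nat_of_le_succ fun n => by
    rw [hK]; exact Finset.subset_insert _ _
  have hcard : ∀ n, (K n).card ≤ n := by
    intro n
    induction n with
    | zero => simp [K]
    | succ n ih => rw [hK]; exact (Finset.card_insert_le _ _).trans (by omega)
  have hlt : ∀ s t : Fin N, s < t → f (K s) ≠ f (K t) := by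
    intro s t hst he
    refine hf (K t) ((hcard t).trans_lt t.2) ?_
    rw [← he]
    exact hmono (Nat.succ_le_of_lt hst) (by rw [hK]; exact Finset.mem_insert_self _ _)
  have hinj : Function.Injective fun t : Fin N => f (K t) := by
    intro s t he
    rcases lt_trichotomy s t with h | h | h
    · exact absurd he (hlt s t h)
    · exact h
    · exact absurd he.symm (hlt t s h)
  let σ : Equiv.Perm (Fin N) := Equiv.ofBijective _ (Finite.injective_iff_bijective.1 hinj)
  have hσ : ∀ t : Fin N, σ t = f (K t) := fun _ => rfl
  have hb : ∀ n, n ≤ N → K n = before σ n := by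
    intro n
    induction n with
    | zero => intro _; ext k; simp [K]
    | succ n ih =>
      intro hn
      rw [hK, before_succ σ ⟨n, hn⟩, hσ, ih (by omega)]
  exact ⟨σ, fun t => by rw [hσ, hb t t.2.le]⟩

/-- The order of the agents, read backwards. -/
def reverseOrder (σ : Equiv.Perm (Fin N)) : Equiv.Perm (Fin N) := Fin.revPerm.trans σ

theorem before_reverseOrder (σ : Equiv.Perm (Fin N)) (t : Fin N) :
    (before (reverseOrder σ) t)ᶜ = before σ ((t.rev : ℕ) + 1) := by
  ext k
  have := (σ.symm k).2
  have := t.2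
  simp only [Finset.mem_compl, mem_before, reverseOrder, Equiv.symm_trans_apply,
    Fin.revPerm_symm, Fin.revPerm_apply, Fin.val_rev]
  omega

/-- An order built backwards by the rule `g` is, read backwards, built forwards by the
rule that applies `g` to the complement. -/
theorem reverse_rule {g : Finset (Fin N) → Fin N} {σ : Equiv.Perm (Fin N)}
    (h : ∀ t : Fin N, σ t = g (before σ (t + 1))) (t : Fin N) :
    reverseOrder σ t = g (before (reverseOrder σ) t)ᶜ := by
  rw [before_reverseOrder]
  exact h t.rev

/-- Two orders that are built backwards by the rules `f` and `g`, each choosing the last agent of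
a set, agree from the position from which the rules do. -/
theorem order_eq_of_backward_rules_eq {f g : Finset (Fin N) → Fin N} {σ τ : Equiv.Perm (Fin N)}
    {j : ℕ} (hσ : ∀ t : Fin N, σ t = f (before σ (t + 1)))
    (hτ : ∀ t : Fin N, τ t = g (before τ (t + 1)))
    (h : ∀ K : Finset (Fin N), j < K.card → f K = g K) (t : Fin N) (ht : j ≤ (t : ℕ)) :
    σ t = τ t := by
  have key := order_eq_of_rules_eq (f := fun K => f Kᶜ) (g := fun K => g Kᶜ) (j := N - j)
    (reverse_rule hσ) (reverse_rule hτ)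
    (fun K hK => h _ (by rw [Finset.card_compl, Fintype.card_fin]; omega)) t.rev
    (by rw [Fin.val_rev]; omega)
  simpa [reverseOrder] using key

/-- A rule that always chooses an element of the set of the remaining agents builds an order, from
its last agent to its first. -/
theorem exists_order_of_backward_rule {g : Finset (Fin N) → Fin N}
    (hg : ∀ K : Finset (Fin N), 0 < K.card → g K ∈ K) :
    ∃ σ : Equiv.Perm (Fin N), ∀ t : Fin N, σ t = g (before σ (t + 1)) := by
  obtain ⟨σ, hσ⟩ := exists_order_of_rule (f := fun K => g Kᶜ) (fun K hK => by
    have := hg Kᶜ (by rw [Finset.card_compl, Fintype.card_fin]; omega)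
    simpa using this)
  refine ⟨reverseOrder σ, fun t => ?_⟩
  have h1 : before (reverseOrder σ) (t + 1) = (before σ (t.rev : ℕ))ᶜ := by
    have := before_reverseOrder (reverseOrder σ) t.rev
    rw [Fin.rev_rev] at this
    rw [← this]
    congr 2
    ext k
    simp [reverseOrder]
  rw [h1]
  exact hσ t.rev

end Orders

/-! ### The branches of the routes -/

section Routes

variable {N : ℕ}

/-- The input list of `A_k` whose only non-null entry is `K.2`, at the time slot `K.1`. -/
def InAt {k : Fin N} (K : Σ t, QArr.Subs t k) (x : (genericIndexed N).InVal (.A k)) : Prop :=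
  inAVal x K.1 = some K.2 ∧ ∀ t, t ≠ K.1 → inAVal x t = none

/-- The output list of `A_k` whose only non-null entry is `K.2`, at the time slot `K.1`. -/
def OutAt {k : Fin N} (K : Σ t, QArr.Subs t k) (y : (genericIndexed N).OutVal (.A k)) : Prop :=
  outAVal y K.1 = some K.2 ∧ ∀ t, t ≠ K.1 → outAVal y t = none

/-- The input lists of `V j` (vacuously, if `j = 0`) with a single non-null entry, equal to `K`. -/
def Arrived (j : Fin (N + 1)) (K : Finset (Fin N)) (x : (genericIndexed N).InVal (.V j)) : Prop :=
  ∀ (s : Fin N) (hs : s.succ = j), ∃ (k : Fin N) (L : QArr.Subs s k),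
    inVVal x s hs k = some L ∧ L.1 = K ∧ ∀ k', k' ≠ k → inVVal x s hs k' = none

/-- The output lists of `V j` (vacuously, if `j` is the last one) with a single non-null entry,
obtained by adding to `K` the agent at whose position it stands. -/
def Departed (j : Fin (N + 1)) (K : Finset (Fin N)) (y : (genericIndexed N).OutVal (.V j)) : Prop :=
  ∀ (t : Fin N) (ht : t.castSucc = j), ∃ (l : Fin N) (L : QArr.Subs t l),
    outVVal y t ht l = some L ∧ L.1 = insert l K ∧ ∀ l', l' ≠ l → outVVal y t ht l' = none

theorem InAt.inj {k : Fin N} {K K' : Σ t, QArr.Subs t k} {x : (genericIndexed N).InVal (.A k)}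
    (h : InAt K x) (h' : InAt K' x) : K = K' := by
  obtain ⟨t, K⟩ := K
  obtain ⟨t', K'⟩ := K'
  have : t = t' := by
    by_contra hne
    have h1 := h.1
    rw [h'.2 t hne] at h1
    simp at h1
  subst this
  have := h.1.symm.trans h'.1
  simp only [Option.some.injEq] at this
  rw [this]

theorem OutAt.inj {k : Fin N} {K K' : Σ t, QArr.Subs t k} {y : (genericIndexed N).OutVal (.A k)}
    (h : OutAt K y) (h' : OutAt K' y) : K = K' := by
  obtain ⟨t, K⟩ := K
  obtain ⟨t', K'⟩ := K'
  have : t = t' := by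
    by_contra hne
    have h1 := h.1
    rw [h'.2 t hne] at h1
    simp at h1
  subst this
  have := h.1.symm.trans h'.1
  simp only [Option.some.injEq] at this
  rw [this]

/-- Index values of all arrows that are null except next to the agent `k` at the time slot `t`,
where they are `K`. This need not satisfy the routes; it only witnesses that blocks are nonempty. -/
def singleAssign (t k : Fin N) (K : QArr.Subs t k) : ∀ a : QArr N, QArr.Ind a
  | .past => ()
  | .future => ()
  | .toA t' k' => (if h : t = t' ∧ k = k' then some (h.1 ▸ h.2 ▸ K) else none :
      Option (QArr.Subs t' k'))
  | .fromA t' k' => (if h : t = t' ∧ k = k' then some (h.1 ▸ h.2 ▸ K) else none :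
      Option (QArr.Subs t' k'))

/-- The branches of `A_k` consist of a single input and a single output each. -/
theorem blocksA (k : Fin N) :
    BlockDecomposition (genericRoute N (.A k)) (InAt (k := k)) (OutAt (k := k)) where
  rel_iff x y := by
    constructor
    · rintro ⟨h, t, ht, hu⟩
      obtain ⟨K, hK⟩ := Option.ne_none_iff_exists'.1 ht
      have hn : ∀ t', t' ≠ t → inAVal x t' = none := fun t' ht' => by
        by_contra hne
        exact ht' (hu t' hne)
      exact ⟨⟨t, K⟩, ⟨hK, hn⟩, ⟨by rw [← h]; exact hK, fun t' ht' => by rw [← h]; exact hn t' ht'⟩⟩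
    · rintro ⟨⟨t, K⟩, hx, hy⟩
      refine ⟨fun t' => ?_, t, ?_, fun t' ht' => ?_⟩
      · by_cases ht : t' = t
        · subst ht; rw [hx.1, hy.1]
        · rw [hx.2 _ ht, hy.2 _ ht]
      · dsimp only; rw [hx.1]; simp
      · by_contra hne
        exact ht' (hx.2 t' hne)
  inj_left _ _ _ := InAt.inj
  inj_right _ _ _ := OutAt.inj
  nonempty_left := fun ⟨t, K⟩ => ⟨fun a => singleAssign t k K a.1, by
    constructor
    · simp [inAVal, singleAssign]
    · intro t' ht'
      simp [inAVal, singleAssign, ht'.symm]⟩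
  nonempty_right := fun ⟨t, K⟩ => ⟨fun a => singleAssign t k K a.1, by
    constructor
    · simp [outAVal, singleAssign]
    · intro t' ht'
      simp [outAVal, singleAssign, ht'.symm]⟩

theorem notMem_of_card_insert {α : Type} [DecidableEq α] {K : Finset α} {l : α} {n : ℕ}
    (h : (insert l K).card = n + 1) (hK : K.card = n) : l ∉ K := by
  intro hl
  rw [Finset.insert_eq_of_mem hl] at h
  omega

/-- For `j = 0`, where `Arrived` is vacuous, the cardinality alone forces `K = ∅`. -/
theorem Arrived.inj {j : Fin (N + 1)} {K K' : Finset (Fin N)} (hK : K.card = j) (hK' : K'.card = j)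
    {x : (genericIndexed N).InVal (.V j)} (h : Arrived j K x) (h' : Arrived j K' x) : K = K' := by
  induction j using Fin.cases with
  | zero =>
    rw [Fin.val_zero, Finset.card_eq_zero] at hK hK'
    rw [hK, hK']
  | succ s =>
    obtain ⟨k, L, hL, rfl, hn⟩ := h s rfl
    obtain ⟨k', L', hL', rfl, hn'⟩ := h' s rfl
    have : k = k' := by
      by_contra hne
      rw [hn' k hne] at hL
      simp at hL
    subst this
    rw [hL, Option.some.injEq] at hL'
    rw [hL']

/-- At the last node, where `Departed` is vacuous, the cardinality alone forces `K` to be the set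
of all agents. -/
theorem Departed.inj {j : Fin (N + 1)} {K K' : Finset (Fin N)} (hK : K.card = j)
    (hK' : K'.card = j) {y : (genericIndexed N).OutVal (.V j)} (h : Departed j K y)
    (h' : Departed j K' y) : K = K' := by
  induction j using Fin.lastCases with
  | last =>
    have h1 := (Finset.card_eq_iff_eq_univ K).1 (by rw [hK]; simp)
    have h2 := (Finset.card_eq_iff_eq_univ K').1 (by rw [hK']; simp)
    rw [h1, h2]
  | cast t =>
    obtain ⟨l, L, hL, hLK, hn⟩ := h t rfl
    obtain ⟨l', L', hL', hLK', hn'⟩ := h' t rfl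
    have : l = l' := by
      by_contra hne
      rw [hn' l hne] at hL
      simp at hL
    subst this
    rw [hL, Option.some.injEq] at hL'
    subst hL'
    have h1 := notMem_of_card_insert (hLK ▸ L.2.1) hK
    have h2 := notMem_of_card_insert (hLK' ▸ L.2.1) hK'
    rw [← Finset.erase_insert h1, ← hLK, hLK', Finset.erase_insert h2]

/-- The branches of `V j` are labelled by the set `K` of the `j` agents that have already acted:
since `L = K ∪ {l}` with `l ∉ K`, the set `K` can be read off from the outputs as well. -/
theorem blocksV (j : Fin (N + 1)) :
    BlockDecomposition (genericRoute N (.V j))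
      (fun (K : {K : Finset (Fin N) // K.card = j}) => Arrived j K.1)
      (fun K => Departed j K.1) where
  rel_iff x y := by
    constructor
    · rintro ⟨h1, h2, h3⟩
      have hin : ∃ K : Finset (Fin N), K.card = j ∧ Arrived j K x := by
        induction j using Fin.cases with
        | zero => exact ⟨∅, by simp, fun s hs => absurd hs (Fin.succ_ne_zero s)⟩
        | succ s =>
          obtain ⟨k, hk, hu⟩ := h1 s rfl
          obtain ⟨K, hK⟩ := Option.ne_none_iff_exists'.1 hk
          refine ⟨K.1, K.2.1, fun s' hs' => ?_⟩
          obtain rfl := Fin.succ_injective _ hs'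
          refine ⟨k, K, hK, rfl, fun k' hk' => ?_⟩
          by_contra hne
          exact hk' (hu k' hne)
      obtain ⟨K, hK, hx⟩ := hin
      refine ⟨⟨K, hK⟩, hx, fun t ht => ?_⟩
      obtain ⟨l, hl, hu⟩ := h2 t ht
      obtain ⟨L, hL⟩ := Option.ne_none_iff_exists'.1 hl
      refine ⟨l, L, hL, ?_, fun l' hl' => ?_⟩
      · induction j using Fin.cases with
        | zero =>
          rw [Fin.val_zero, Finset.card_eq_zero] at hK
          have ht0 : (t : ℕ) = 0 := by simpa using congrArg Fin.val ht
          obtain ⟨a, ha⟩ := Finset.card_eq_one.1 (by rw [L.2.1, ht0] : L.1.card = 1)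
          have := L.2.2
          rw [ha, Finset.mem_singleton] at this
          change L.1 = insert l K
          rw [ha, hK, this]
          rfl
        | succ s =>
          obtain ⟨k, K', hK', rfl, -⟩ := hx s rfl
          exact h3 s t rfl ht k l K' L hK' hL
      · by_contra hne
        exact hl' (hu l' hne)
    · rintro ⟨⟨K, hK⟩, hx, hy⟩
      refine ⟨fun s hs => ?_, fun t ht => ?_, fun s t hs ht k l K' L hK' hL => ?_⟩
      · obtain ⟨k, L, hL, -, hn⟩ := hx s hs
        refine ⟨k, by dsimp only; rw [hL]; simp, fun k' hk' => ?_⟩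
        by_contra hne
        exact hk' (hn k' hne)
      · obtain ⟨k, L, hL, -, hn⟩ := hy t ht
        refine ⟨k, by dsimp only; rw [hL]; simp, fun k' hk' => ?_⟩
        by_contra hne
        exact hk' (hn k' hne)
      · obtain ⟨k', K'', hK'', h1, hn⟩ := hx s hs
        obtain ⟨l', L', hL', h2, hn'⟩ := hy t ht
        have hk : k = k' := by
          by_contra hne
          rw [hn k hne] at hK'
          simp at hK'
        have hl : l = l' := by
          by_contra hne
          rw [hn' l hne] at hL
          simp at hL
        subst hk hl
        rw [hK', Option.some.injEq] at hK''
        rw [hL, Option.some.injEq] at hL'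
        subst hK'' hL'
        rw [h2, h1]
  inj_left K K' _ h h' := Subtype.ext (Arrived.inj K.2 K'.2 h h')
  inj_right K K' _ h h' := Subtype.ext (Departed.inj K.2 K'.2 h h')
  nonempty_left := fun ⟨K, hK⟩ => by
    induction j using Fin.cases with
    | zero => exact ⟨fun a => Classical.arbitrary _, fun s hs => absurd hs (Fin.succ_ne_zero s)⟩
    | succ s =>
      obtain ⟨k, hk⟩ := Finset.card_pos.1 (by rw [hK, Fin.val_succ]; omega : 0 < K.card)
      refine ⟨fun a => singleAssign s k ⟨K, hK, hk⟩ a.1, fun s' hs' => ?_⟩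
      obtain rfl := Fin.succ_injective _ hs'
      exact ⟨k, ⟨K, hK, hk⟩, by simp [inVVal, singleAssign], rfl, fun k' hk' => by
        simp [inVVal, singleAssign, hk'.symm]⟩
  nonempty_right := fun ⟨K, hK⟩ => by
    induction j using Fin.lastCases with
    | last =>
      exact ⟨fun a => Classical.arbitrary _, fun t ht => absurd ht (Fin.castSucc_lt_last t).ne⟩
    | cast t =>
      obtain ⟨l, hl⟩ : ∃ l, l ∉ K := by
        by_contra! hall
        have := (Finset.card_eq_iff_eq_univ K).2 (Finset.eq_univ_iff_forall.2 hall)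
        rw [hK, Fintype.card_fin, Fin.val_castSucc] at this
        exact t.2.ne this
      have hL : (insert l K).card = (t : ℕ) + 1 := by
        rw [Finset.card_insert_of_notMem hl, hK, Fin.val_castSucc]
      refine ⟨fun a => singleAssign t l ⟨insert l K, hL, Finset.mem_insert_self _ _⟩ a.1,
        fun t' ht' => ?_⟩
      obtain rfl := Fin.castSucc_injective _ ht'
      exact ⟨l, ⟨insert l K, hL, Finset.mem_insert_self _ _⟩, by simp [outVVal, singleAssign], rfl,
        fun l' hl' => by simp [outVVal, singleAssign, hl'.symm]⟩

end Routes

/-! ### Consistent assignments of index values are orders of the agents -/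

section Assignments

variable {N : ℕ}

/-- The index value at time slot `t` and agent `k` when the agents act in the order `σ`. -/
def slotValue (σ : Equiv.Perm (Fin N)) (t k : Fin N) : Option (QArr.Subs t k) :=
  if h : σ t = k then
    some ⟨before σ (t + 1), card_before σ (Nat.succ_le_of_lt t.2), h ▸ apply_mem_before σ t⟩
  else none

theorem slotValue_self (σ : Equiv.Perm (Fin N)) (t : Fin N) :
    slotValue σ t (σ t) = some ⟨before σ (t + 1), card_before σ (Nat.succ_le_of_lt t.2),
      apply_mem_before σ t⟩ := by
  simp [slotValue]

theorem slotValue_of_ne {σ : Equiv.Perm (Fin N)} {t k : Fin N} (h : σ t ≠ k) :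
    slotValue σ t k = none := by
  simp [slotValue, h]

/-- The index values of all the arrows when the agents act in the order `σ`. -/
def assign (σ : Equiv.Perm (Fin N)) : ∀ a : QArr N, QArr.Ind a
  | .past => ()
  | .future => ()
  | .toA t k => slotValue σ t k
  | .fromA t k => slotValue σ t k

/-- The branch of `A_k` for the set `K.2` at the time slot `K.1`. -/
abbrev branchA (k : Fin N) (K : Σ t, QArr.Subs t k) : Branch (genericRoute N (.A k)) :=
  (blocksA k).branch K

/-- The branch of `V j` for the set `K` of the agents that have already acted. -/
abbrev branchV (j : Fin (N + 1)) (K : Finset (Fin N)) (hK : K.card = j) :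
    Branch (genericRoute N (.V j)) :=
  (blocksV j).branch ⟨K, hK⟩

/-- The branches that happen when the agents act in the order `σ`. -/
def branchAt (σ : Equiv.Perm (Fin N)) : ∀ n : QNode N, Branch (genericRoute N n)
  | .A k => branchA k ⟨σ.symm k, before σ (σ.symm k + 1),
      card_before σ (Nat.succ_le_of_lt (σ.symm k).2), by simp⟩
  | .V j => branchV j (before σ j) (card_before σ (Nat.lt_succ_iff.1 j.2))

theorem assign_mem_dom (σ : Equiv.Perm (Fin N)) (n : QNode N) :
    (fun a : (genericIndexed N).In n => assign σ a.1) ∈ (branchAt σ n).dom := by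
  cases n with
  | A k =>
    obtain ⟨t, rfl⟩ := σ.surjective k
    refine ⟨?_, fun t' ht' => slotValue_of_ne ?_⟩
    · change slotValue σ (σ.symm (σ t)) (σ t) = _
      simp [slotValue]
    · rintro h
      exact ht' (by simp [← h])
  | V j =>
    rintro s rfl
    exact ⟨σ s, _, slotValue_self σ s, rfl, fun k' hk' => slotValue_of_ne hk'.symm⟩

theorem assign_mem_cod (σ : Equiv.Perm (Fin N)) (n : QNode N) :
    (fun a : (genericIndexed N).Out n => assign σ a.1) ∈ (branchAt σ n).cod := by
  cases n with
  | A k =>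
    obtain ⟨t, rfl⟩ := σ.surjective k
    refine ⟨?_, fun t' ht' => slotValue_of_ne ?_⟩
    · change slotValue σ (σ.symm (σ t)) (σ t) = _
      simp [slotValue]
    · rintro h
      exact ht' (by simp [← h])
  | V j =>
    rintro t rfl
    exact ⟨σ t, _, slotValue_self σ t, before_succ σ t, fun k' hk' => slotValue_of_ne hk'.symm⟩

/-- An assignment of index values to all the arrows that satisfies all the routes. -/
def IsConsistent (x : ∀ a : QArr N, QArr.Ind a) : Prop :=
  ∀ n : QNode N, genericRoute N n (fun a : (genericIndexed N).In n => x a.1)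
    (fun a : (genericIndexed N).Out n => x a.1)

/-- The consistent assignments correspond to the orders of the agents: along the time
slots the non-null value grows by one agent each time. -/
theorem IsConsistent.exists_eq_assign {x : ∀ a : QArr N, QArr.Ind a} (hx : IsConsistent x) :
    ∃ σ, x = assign σ := by
  have h1 : ∀ t : Fin N, ∃ (l : Fin N) (L : QArr.Subs t l), x (.toA t l) = some L ∧
      ∀ l', l' ≠ l → x (.toA t l') = (none : Option (QArr.Subs t l')) := by
    intro t
    obtain ⟨l, hl, hu⟩ := (hx (.V t.castSucc)).2.1 t rfl
    obtain ⟨L, hL⟩ := Option.ne_none_iff_exists'.1 hl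
    refine ⟨l, L, hL, fun l' hl' => ?_⟩
    by_contra hne
    exact hl' (hu l' hne)
  choose f L hL hn using h1
  have hfrom : ∀ t k : Fin N, (x (.fromA t k) : Option (QArr.Subs t k)) = x (.toA t k) :=
    fun t k => ((hx (.A k)).1 t).symm
  have hL' : ∀ n (hn : n < N), (L ⟨n, hn⟩).1 =
      (Finset.univ.filter fun s : Fin N => (s : ℕ) ≤ n).image f := by
    intro n
    induction n with
    | zero =>
      intro h0
      obtain ⟨a, ha⟩ := Finset.card_eq_one.1 (L ⟨0, h0⟩).2.1
      have := (L ⟨0, h0⟩).2.2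
      rw [ha, Finset.mem_singleton] at this
      have h2 : (Finset.univ.filter fun s : Fin N => (s : ℕ) ≤ 0) = {⟨0, h0⟩} := by
        ext s; simp [Fin.ext_iff]
      rw [ha, h2, Finset.image_singleton, this]
    | succ n ih =>
      intro h0
      have h2 : (Finset.univ.filter fun s : Fin N => (s : ℕ) ≤ n + 1) =
          insert ⟨n + 1, h0⟩ (Finset.univ.filter fun s : Fin N => (s : ℕ) ≤ n) := by
        ext s; simp [Fin.ext_iff]; omega
      rw [h2, Finset.image_insert, ← ih (by omega)]
      exact (hx (.V ⟨n + 1, by omega⟩)).2.2 ⟨n, by omega⟩ ⟨n + 1, h0⟩ rfl rfl _ _ _ _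
        ((hfrom _ _).trans (hL ⟨n, by omega⟩)) (hL ⟨n + 1, h0⟩)
  have hinj : Function.Injective f := by
    rcases Nat.eq_zero_or_pos N with rfl | hN
    · exact fun a => a.elim0
    have h2 := (L ⟨N - 1, by omega⟩).2.1
    have h3 : (Finset.univ.filter fun s : Fin N => (s : ℕ) ≤ N - 1) = Finset.univ := by
      ext s; simp; omega
    rw [hL', h3] at h2
    rw [← Set.injOn_univ, ← Finset.coe_univ, ← Finset.card_image_iff, h2, Finset.card_fin]
    simp only
    omega
  let σ : Equiv.Perm (Fin N) := Equiv.ofBijective f (Finite.injective_iff_bijective.1 hinj)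
  have hσ : ∀ t, σ t = f t := fun _ => rfl
  have hto : ∀ t k : Fin N, (x (.toA t k) : Option (QArr.Subs t k)) = slotValue σ t k := by
    intro t k
    by_cases hk : k = f t
    · subst hk
      refine (hL t).trans ((slotValue_self σ t).trans ?_).symm
      refine congrArg some (Subtype.ext ?_)
      change before σ (t + 1) = (L t).1
      rw [hL' t t.2]
      ext k
      simp only [mem_before, Finset.mem_image, Finset.mem_filter, Finset.mem_univ, true_and]
      constructor
      · intro h
        exact ⟨σ.symm k, Nat.lt_succ_iff.1 h, by rw [← hσ, Equiv.apply_symm_apply]⟩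
      · rintro ⟨s, hs, rfl⟩
        rw [← hσ, Equiv.symm_apply_apply]
        exact Nat.lt_succ_iff.2 hs
    · rw [slotValue_of_ne (fun h => hk h.symm)]
      exact hn t k hk
  refine ⟨σ, funext fun a => ?_⟩
  cases a with
  | past => rfl
  | future => rfl
  | toA t k => exact hto t k
  | fromA t k => exact (hfrom t k).trans (hto t k)

end Assignments

/-! ### Lists of index values in a branch -/

section Extensionality

variable {N : ℕ}

theorem InAt.ext {k : Fin N} {K : Σ t, QArr.Subs t k} {x x' : (genericIndexed N).InVal (.A k)}
    (h : InAt K x) (h' : InAt K x') : x = x' := by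
  have key : ∀ t, inAVal x t = inAVal x' t := by
    intro t
    by_cases ht : t = K.1
    · subst ht; rw [h.1, h'.1]
    · rw [h.2 t ht, h'.2 t ht]
  funext ⟨a, ha⟩
  cases a with
  | past => cases ha
  | future => cases ha
  | toA t k' =>
    cases ha
    exact key t
  | fromA t k' => cases ha

theorem OutAt.ext {k : Fin N} {K : Σ t, QArr.Subs t k} {y y' : (genericIndexed N).OutVal (.A k)}
    (h : OutAt K y) (h' : OutAt K y') : y = y' := by
  have key : ∀ t, outAVal y t = outAVal y' t := by
    intro t
    by_cases ht : t = K.1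
    · subst ht; rw [h.1, h'.1]
    · rw [h.2 t ht, h'.2 t ht]
  funext ⟨a, ha⟩
  cases a with
  | past => cases ha
  | future => cases ha
  | fromA t k' =>
    cases ha
    exact key t
  | toA t k' => cases ha

theorem Arrived.ext {j : Fin (N + 1)} {K : Finset (Fin N)} {x x' : (genericIndexed N).InVal (.V j)}
    (h : Arrived j K x) (h' : Arrived j K x')
    (hk : ∀ (s : Fin N) (hs : s.succ = j), ∃ k, inVVal x s hs k ≠ none ∧ inVVal x' s hs k ≠ none) :
    x = x' := by
  have key : ∀ (s : Fin N) (hs : s.succ = j) k, inVVal x s hs k = inVVal x' s hs k := by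
    intro s hs k
    obtain ⟨k0, h1, h2⟩ := hk s hs
    obtain ⟨k1, L, hL, hLK, hn⟩ := h s hs
    obtain ⟨k2, L', hL', hLK', hn'⟩ := h' s hs
    have e1 : k0 = k1 := by by_contra hne; exact h1 (hn _ hne)
    have e2 : k0 = k2 := by by_contra hne; exact h2 (hn' _ hne)
    subst e1 e2
    by_cases hkk : k = k0
    · subst hkk
      rw [hL, hL']
      exact congrArg some (Subtype.ext (hLK.trans hLK'.symm))
    · rw [hn k hkk, hn' k hkk]
  funext ⟨a, ha⟩
  cases a with
  | past => rfl
  | future => cases ha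
  | toA t k' => cases ha
  | fromA s k =>
    cases ha
    exact key s rfl k

theorem Departed.ext {j : Fin (N + 1)} {K : Finset (Fin N)}
    {y y' : (genericIndexed N).OutVal (.V j)} (h : Departed j K y) (h' : Departed j K y')
    (hk : ∀ (t : Fin N) (ht : t.castSucc = j), ∃ l,
      outVVal y t ht l ≠ none ∧ outVVal y' t ht l ≠ none) :
    y = y' := by
  have key : ∀ (t : Fin N) (ht : t.castSucc = j) l, outVVal y t ht l = outVVal y' t ht l := by
    intro s hs k
    obtain ⟨k0, h1, h2⟩ := hk s hs
    obtain ⟨k1, L, hL, hLK, hn⟩ := h s hs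
    obtain ⟨k2, L', hL', hLK', hn'⟩ := h' s hs
    have e1 : k0 = k1 := by by_contra hne; exact h1 (hn _ hne)
    have e2 : k0 = k2 := by by_contra hne; exact h2 (hn' _ hne)
    subst e1 e2
    by_cases hkk : k = k0
    · subst hkk
      rw [hL, hL']
      exact congrArg some (Subtype.ext (hLK.trans hLK'.symm))
    · rw [hn k hkk, hn' k hkk]
  funext ⟨a, ha⟩
  cases a with
  | past => cases ha
  | future => rfl
  | fromA t k' => cases ha
  | toA s k =>
    cases ha
    exact key s rfl k

theorem openTrivial (a : QArr N) (h : a.src = none ∨ a.tgt = none) : Subsingleton a.Ind := by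
  cases a with
  | past => exact inferInstanceAs (Subsingleton Unit)
  | future => exact inferInstanceAs (Subsingleton Unit)
  | toA t k => simp [QArr.src, QArr.tgt] at h
  | fromA t k => simp [QArr.src, QArr.tgt] at h

theorem isBranched_genericRoute (n : QNode N) : IsBranched (genericRoute N n) := by
  cases n with
  | A k => exact (blocksA k).isBranched
  | V j => exact (blocksV j).isBranched

theorem isBranched_genericRoute_transpose (n : QNode N) :
    IsBranched fun y x => genericRoute N n x y := by
  cases n with
  | A k => exact (blocksA k).transpose.isBranched
  | V j => exact (blocksV j).transpose.isBranched

end Extensionality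

/-! ### Bifurcation choices and bi-univocality -/

section Univocality

variable {N : ℕ}

theorem exists_departure (c : (generic N).Choices) (t : Fin N) (K : Finset (Fin N))
    (hK : K.card = t) : ∃ l, outVVal (c (.V t.castSucc) (branchV t.castSucc K hK)).1 t rfl l ≠
      none := by
  have h : Departed t.castSucc K (c (.V t.castSucc) (branchV t.castSucc K hK)).1 :=
    (c (.V t.castSucc) (branchV t.castSucc K hK)).2
  obtain ⟨l, L, hL, -⟩ := h t rfl
  exact ⟨l, by rw [hL]; simp⟩

theorem exists_arrival (c : (generic N).adjoint.Choices) (s : Fin N) (K : Finset (Fin N))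
    (hK : K.card = (s : ℕ) + 1) :
    ∃ k, inVVal (c (.V s.succ) (branchV s.succ K hK).transpose).1 s rfl k ≠ none := by
  have h : Arrived s.succ K (c (.V s.succ) (branchV s.succ K hK).transpose).1 :=
    (c (.V s.succ) (branchV s.succ K hK).transpose).2
  obtain ⟨l, L, hL, -⟩ := h s rfl
  exact ⟨l, by rw [hL]; simp⟩

variable [NeZero N]

open Classical in
/-- The agent to whom the bifurcation choices `c` send the system after the agents in `K`
(an arbitrary agent, if `K` contains all the agents). -/
noncomputable def nextAgent (c : (generic N).Choices) (K : Finset (Fin N)) : Fin N :=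
  if h : K.card < N then Classical.choose (exists_departure c ⟨K.card, h⟩ K rfl) else 0

open Classical in
/-- The agent of `K` from whom the bifurcation choices `c` of the adjoint graph let the system come
(an arbitrary agent, if `K` is empty). -/
noncomputable def lastAgent (c : (generic N).adjoint.Choices) (K : Finset (Fin N)) : Fin N :=
  if h : 0 < K.card ∧ K.card ≤ N then
    Classical.choose (exists_arrival c ⟨K.card - 1, by omega⟩ K (Nat.sub_add_cancel h.1).symm) else 0

theorem nextAgent_spec (c : (generic N).Choices) {t : Fin N} {K : Finset (Fin N)}
    (hK : K.card = t) :
    outVVal (c (.V t.castSucc) (branchV t.castSucc K hK)).1 t rfl (nextAgent c K) ≠ none := by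
  have hlt : K.card < N := hK ▸ t.2
  obtain rfl : t = ⟨K.card, hlt⟩ := Fin.ext hK.symm
  rw [nextAgent, dif_pos hlt]
  exact Classical.choose_spec (exists_departure c ⟨K.card, hlt⟩ K rfl)

theorem lastAgent_spec (c : (generic N).adjoint.Choices) {s : Fin N} {K : Finset (Fin N)}
    (hK : K.card = (s : ℕ) + 1) :
    inVVal (c (.V s.succ) (branchV s.succ K hK).transpose).1 s rfl (lastAgent c K) ≠ none := by
  have hlt : 0 < K.card ∧ K.card ≤ N := by omega
  obtain ⟨n, hn⟩ := s
  obtain rfl : n = K.card - 1 := by simp only at hK; omega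
  rw [lastAgent, dif_pos hlt]
  exact Classical.choose_spec (exists_arrival c ⟨K.card - 1, by omega⟩ K _)

theorem nextAgent_notMem (c : (generic N).Choices) (K : Finset (Fin N)) (hK : K.card < N) :
    nextAgent c K ∉ K := by
  have hd : Departed (Fin.castSucc ⟨K.card, hK⟩) K _ :=
    (c (.V (Fin.castSucc ⟨K.card, hK⟩)) (branchV (Fin.castSucc ⟨K.card, hK⟩) K rfl)).2
  obtain ⟨l, L, hL, hLK, hn⟩ := hd ⟨K.card, hK⟩ rfl
  have hl : nextAgent c K = l := by
    by_contra hne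
    exact nextAgent_spec c (t := ⟨K.card, hK⟩) (K := K) rfl (hn _ hne)
  rw [hl]
  exact notMem_of_card_insert (hLK ▸ L.2.1) rfl

theorem lastAgent_mem (c : (generic N).adjoint.Choices) (K : Finset (Fin N)) (hK : 0 < K.card) :
    lastAgent c K ∈ K := by
  have hN : K.card ≤ N := by simpa using K.card_le_univ
  have hs : K.card = ((⟨K.card - 1, by omega⟩ : Fin N) : ℕ) + 1 := (Nat.sub_add_cancel hK).symm
  have ha : Arrived (Fin.succ ⟨K.card - 1, by omega⟩) K _ :=
    (c (.V (Fin.succ ⟨K.card - 1, by omega⟩)) (branchV _ K hs).transpose).2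
  obtain ⟨l, L, hL, hLK, hn⟩ := ha ⟨K.card - 1, by omega⟩ rfl
  have hl : lastAgent c K = l := by
    by_contra hne
    exact lastAgent_spec c hs (hn _ hne)
  rw [hl, ← hLK]
  exact L.2.2

theorem nextAgent_congr {c c' : (generic N).Choices} {K : Finset (Fin N)}
    (h : ∀ (t : Fin N) (hK : K.card = t), c (.V t.castSucc) (branchV t.castSucc K hK) =
      c' (.V t.castSucc) (branchV t.castSucc K hK)) : nextAgent c K = nextAgent c' K := by
  unfold nextAgent
  split_ifs with hK
  · simp only [h ⟨K.card, hK⟩ rfl]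
  · rfl

theorem lastAgent_congr {c c' : (generic N).adjoint.Choices} {K : Finset (Fin N)}
    (h : ∀ (s : Fin N) (hK : K.card = (s : ℕ) + 1),
      c (.V s.succ) (branchV s.succ K hK).transpose =
        c' (.V s.succ) (branchV s.succ K hK).transpose) : lastAgent c K = lastAgent c' K := by
  unfold lastAgent
  split_ifs with hK
  · simp only [h ⟨K.card - 1, by omega⟩ (Nat.sub_add_cancel hK.1).symm]
  · rfl

/-- The bifurcation choices select the order in which the next agent is always the chosen one. -/
theorem choiceRel_iff {u : ∀ a : (generic N).OpenIn, (generic N).Ind a.1} {c : (generic N).Choices}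
    {v : ∀ a : (generic N).OpenOut, (generic N).Ind a.1}
    {b : ∀ n : QNode N, Branch (genericRoute N n)} :
    (generic N).ChoiceRel u c v b ↔
      ∃ σ : Equiv.Perm (Fin N), (∀ t, σ t = nextAgent c (before σ t)) ∧ b = branchAt σ := by
  constructor
  · rintro ⟨x, -, -, hx⟩
    have hcons : IsConsistent x := fun n => (hx n).rel
    obtain ⟨σ, rfl⟩ := hcons.exists_eq_assign
    have hb : b = branchAt σ := funext fun n => Branch.eq_of_mem_dom (hx n).1 (assign_mem_dom σ n)
    refine ⟨σ, fun t => ?_, hb⟩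
    subst hb
    have h1 := nextAgent_spec c (card_before σ t.2.le)
    have h2 : (fun a : (genericIndexed N).Out (.V t.castSucc) => assign σ a.1) = _ :=
      (hx (.V t.castSucc)).2
    by_contra hne
    refine h1 ?_
    refine Eq.trans (congrFun h2.symm (outV t _)) ?_
    exact slotValue_of_ne hne
  · rintro ⟨σ, hσ, rfl⟩
    refine ⟨assign σ, fun a => ?_, fun a => ?_, fun n => ⟨assign_mem_dom σ n, ?_⟩⟩
    · exact (openTrivial a.1 (.inl a.2)).elim _ _
    · exact (openTrivial a.1 (.inr a.2)).elim _ _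
    · have h1 := assign_mem_cod σ n
      have h2 := (c n (branchAt σ n)).2
      cases n with
      | A k => exact OutAt.ext h1 h2
      | V j =>
        have key : ∀ (t : Fin N) (ht : t.castSucc = j), slotValue σ t (σ t) ≠ none ∧
            outVVal (c (.V j) (branchAt σ (.V j))).1 t ht (σ t) ≠ none := by
          rintro t rfl
          have h3 := nextAgent_spec c (card_before σ t.2.le)
          rw [← hσ] at h3
          exact ⟨by rw [slotValue_self]; simp, h3⟩
        exact Departed.ext h1 h2 fun t ht => ⟨σ t, key t ht⟩

/-- In the adjoint graph the bifurcation choices select the order in which the previous agent is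
always the chosen one. -/
theorem adjoint_choiceRel_iff {u : ∀ a : (generic N).adjoint.OpenIn, (generic N).Ind a.1}
    {c : (generic N).adjoint.Choices}
    {v : ∀ a : (generic N).adjoint.OpenOut, (generic N).Ind a.1}
    {b : ∀ n : QNode N, Branch fun y x => genericRoute N n x y} :
    (generic N).adjoint.ChoiceRel u c v b ↔
      ∃ σ : Equiv.Perm (Fin N), (∀ t : Fin N, σ t = lastAgent c (before σ (t + 1))) ∧
        b = fun n => (branchAt σ n).transpose := by
  constructor
  · rintro ⟨x, -, -, hx⟩
    have hcons : IsConsistent x := fun n => (hx n).rel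
    obtain ⟨σ, rfl⟩ := hcons.exists_eq_assign
    have hb : b = fun n => (branchAt σ n).transpose :=
      funext fun n => Branch.eq_of_mem_dom (hx n).1 (assign_mem_cod σ n)
    refine ⟨σ, fun t => ?_, hb⟩
    subst hb
    have h1 := lastAgent_spec c (card_before σ (Nat.succ_le_of_lt t.2))
    have h2 : (fun a : (genericIndexed N).In (.V t.succ) => assign σ a.1) = _ :=
      (hx (.V t.succ)).2
    by_contra hne
    refine h1 ?_
    refine Eq.trans (congrFun h2.symm (inV t _)) ?_
    exact slotValue_of_ne hne
  · rintro ⟨σ, hσ, rfl⟩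
    refine ⟨assign σ, fun a => ?_, fun a => ?_, fun n => ⟨assign_mem_cod σ n, ?_⟩⟩
    · exact (openTrivial a.1 (.inr a.2)).elim _ _
    · exact (openTrivial a.1 (.inl a.2)).elim _ _
    · have h1 := assign_mem_dom σ n
      have h2 := (c n (branchAt σ n).transpose).2
      cases n with
      | A k => exact InAt.ext h1 h2
      | V j =>
        have key : ∀ (s : Fin N) (hs : s.succ = j), slotValue σ s (σ s) ≠ none ∧
            inVVal (c (.V j) (branchAt σ (.V j)).transpose).1 s hs (σ s) ≠ none := by
          rintro s rfl
          have h3 := lastAgent_spec c (card_before σ (Nat.succ_le_of_lt s.2))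
          rw [← hσ] at h3
          exact ⟨by rw [slotValue_self]; simp, h3⟩
        exact Arrived.ext h1 h2 fun s hs => ⟨σ s, key s hs⟩

theorem univocal_generic : (generic N).Univocal where
  branched := isBranched_genericRoute
  openTrivial := openTrivial
  isFunction u c := by
    obtain ⟨σ, hσ⟩ := exists_order_of_rule (nextAgent_notMem c)
    refine ⟨(fun a => Classical.arbitrary _, branchAt σ), choiceRel_iff.2 ⟨σ, hσ, rfl⟩, ?_⟩
    rintro ⟨v, b⟩ h
    obtain ⟨τ, hτ, rfl⟩ := choiceRel_iff.1 h
    obtain rfl : τ = σ := Equiv.ext fun t =>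
      order_eq_of_rules_eq hτ hσ (j := N) (fun _ _ => rfl) t t.2
    refine Prod.ext (funext fun a => ?_) rfl
    exact (openTrivial a.1 (.inr a.2)).elim _ _

theorem univocal_adjoint_generic : (generic N).adjoint.Univocal where
  branched := isBranched_genericRoute_transpose
  openTrivial a h := openTrivial a h.symm
  isFunction u c := by
    obtain ⟨σ, hσ⟩ := exists_order_of_backward_rule (lastAgent_mem c)
    refine ⟨(fun a => Classical.arbitrary _, fun n => (branchAt σ n).transpose),
      adjoint_choiceRel_iff.2 ⟨σ, hσ, rfl⟩, ?_⟩
    rintro ⟨v, b⟩ h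
    obtain ⟨τ, hτ, rfl⟩ := adjoint_choiceRel_iff.1 h
    obtain rfl : τ = σ := Equiv.ext fun t =>
      order_eq_of_backward_rules_eq hτ hσ (j := 0) (fun _ _ => rfl) t (Nat.zero_le _)
    refine Prod.ext (funext fun a => ?_) rfl
    exact (openTrivial a.1 (.inl a.2)).elim _ _

end Univocality

/-! ### The branch graph is acyclic -/

section BranchGraph

variable {N : ℕ}

/-- The time slot of a branch of `A_k`. -/
noncomputable def slotOf {k : Fin N} (b : Branch (genericRoute N (.A k))) : Fin N :=
  (Classical.choose ((blocksA k).exists_branch_eq b)).1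

theorem exists_eq_branchA {k : Fin N} (b : Branch (genericRoute N (.A k))) :
    ∃ K : QArr.Subs (slotOf b) k, b = branchA k ⟨slotOf b, K⟩ :=
  ⟨(Classical.choose ((blocksA k).exists_branch_eq b)).2,
    Classical.choose_spec ((blocksA k).exists_branch_eq b)⟩

/-- The time at which a branch can happen; it increases along all arrows of the branch graph. -/
noncomputable def branchTime : (generic N).BranchNode → ℕ
  | ⟨.A _, b⟩ => 2 * (slotOf b : ℕ) + 1
  | ⟨.V j, _⟩ => 2 * (j : ℕ)

/-- Along an arrow between the branch of an internal node and that of an agent, the value is not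
null only if the time slots of the arrow and of the agent's branch agree. -/
theorem branchTime_lt_of_strongParent {b g : (generic N).BranchNode}
    (h : (generic N).StrongParent (nullOneDim N) b g) : branchTime b < branchTime g := by
  obtain ⟨a, hs, ht, hv⟩ := h
  obtain ⟨n, b⟩ := b
  obtain ⟨n', g⟩ := g
  have hnull : ¬ ∀ v ∈ (generic N).LinkVal ⟨n, b⟩ ⟨n', g⟩ a, v ∈ nullOneDim N a ∧
      (nullOneDim N a).Subsingleton := by
    intro hall
    rcases hv with ⟨v, hv, hv'⟩ | ⟨v, hv, w, hw, hne⟩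
    · exact hv' (hall v hv).1
    · exact hne ((hall v hv).2 (hall v hv).1 (hall w hw).1)
  cases a with
  | past => cases hs
  | future => cases ht
  | toA t k =>
    cases hs
    cases ht
    obtain ⟨K, hK⟩ := exists_eq_branchA g
    have htime : t = slotOf g := by
      by_contra hne
      refine hnull ?_
      rintro _ ⟨x, rfl, -, -, hx⟩
      rw [show (⟨.A k, g⟩ : (generic N).BranchNode).2 = _ from hK] at hx
      exact ⟨hx.2 t hne, Set.subsingleton_singleton⟩
    simp only [branchTime, ← htime, Fin.val_castSucc]
    omega
  | fromA t k =>
    cases hs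
    cases ht
    obtain ⟨K, hK⟩ := exists_eq_branchA b
    have htime : t = slotOf b := by
      by_contra hne
      refine hnull ?_
      rintro _ ⟨x, rfl, -, hx, -⟩
      rw [show (⟨.A k, b⟩ : (generic N).BranchNode).2 = _ from hK] at hx
      exact ⟨hx.2 t hne, Set.subsingleton_singleton⟩
    simp only [branchTime, ← htime, Fin.val_succ]
    omega

theorem branchAt_A_eq_iff {σ : Equiv.Perm (Fin N)} {k : Fin N} {K : Σ t, QArr.Subs t k} :
    branchAt σ (.A k) = branchA k K ↔ σ K.1 = k ∧ before σ (K.1 + 1) = K.2.1 := by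
  constructor
  · intro h
    have h1 : InAt K fun a => assign σ a.1 := by
      have := assign_mem_dom σ (.A k)
      rw [h] at this
      exact this
    have h2 : slotValue σ K.1 k = some K.2 := h1.1
    by_cases hk : σ K.1 = k
    · refine ⟨hk, ?_⟩
      rw [slotValue, dif_pos hk, Option.some.injEq] at h2
      rw [← h2]
    · rw [slotValue_of_ne hk] at h2
      simp at h2
  · obtain ⟨t, K, hK, hk⟩ := K
    rintro ⟨h1, h2⟩
    dsimp only at h1 h2
    subst h1 h2
    refine Branch.eq_of_mem_dom (assign_mem_dom σ (.A (σ t))) ⟨slotValue_self σ t, ?_⟩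
    exact fun t' ht' => slotValue_of_ne fun h => ht' (σ.injective h)

/-- Whether a branch happens depends only on an initial part of the order: on the positions
before `j` for a branch of `V j`, and on those up to `t` for a branch of `A_k` at time slot `t`. -/
theorem branchAt_congr_of_lt {σ τ : Equiv.Perm (Fin N)} {g : (generic N).BranchNode} {j : ℕ}
    (hj : branchTime g ≤ 2 * j) (h : ∀ t : Fin N, (t : ℕ) < j → σ t = τ t) :
    branchAt σ g.1 = g.2 ↔ branchAt τ g.1 = g.2 := by
  obtain ⟨n, g⟩ := g
  cases n with
  | A k =>
    obtain ⟨K, hK⟩ := exists_eq_branchA g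
    simp only [branchTime] at hj
    have hb : before σ (slotOf g + 1) = before τ (slotOf g + 1) :=
      before_congr fun t ht => h t (by omega)
    dsimp only
    generalize slotOf g = t at *
    subst hK
    have e1 := branchAt_A_eq_iff (σ := σ) (K := ⟨t, K⟩)
    have e2 := branchAt_A_eq_iff (σ := τ) (K := ⟨t, K⟩)
    dsimp only at e1 e2
    rw [h t (by omega), hb] at e1
    exact e1.trans e2.symm
  | V i =>
    simp only [branchTime] at hj
    have hb : before σ i = before τ i := before_congr fun t ht => h t (by omega)
    have : branchAt σ (.V i) = branchAt τ (.V i) := by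
      simp only [branchAt, hb]
    simp only [this]

/-- Whether a branch happens depends only on a final part of the order: on the positions
from `j` on for a branch of `V j`, and on those from `t` on for a branch of `A_k` at time slot
`t`. -/
theorem branchAt_congr_of_ge {σ τ : Equiv.Perm (Fin N)} {g : (generic N).BranchNode} {j : ℕ}
    (hj : 2 * j ≤ branchTime g) (h : ∀ t : Fin N, j ≤ (t : ℕ) → σ t = τ t) :
    branchAt σ g.1 = g.2 ↔ branchAt τ g.1 = g.2 := by
  obtain ⟨n, g⟩ := g
  cases n with
  | A k =>
    obtain ⟨K, hK⟩ := exists_eq_branchA g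
    simp only [branchTime] at hj
    have hb : before σ (slotOf g + 1) = before τ (slotOf g + 1) :=
      before_congr_of_ge fun t ht => h t (by omega)
    dsimp only
    generalize slotOf g = t at *
    subst hK
    have e1 := branchAt_A_eq_iff (σ := σ) (K := ⟨t, K⟩)
    have e2 := branchAt_A_eq_iff (σ := τ) (K := ⟨t, K⟩)
    dsimp only at e1 e2
    rw [h t (by omega), hb] at e1
    exact e1.trans e2.symm
  | V i =>
    simp only [branchTime] at hj
    have hb : before σ i = before τ i := before_congr_of_ge fun t ht => h t (by omega)
    have : branchAt σ (.V i) = branchAt τ (.V i) := by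
      simp only [branchAt, hb]
    simp only [this]

variable [NeZero N]

theorem happens_iff {c : (generic N).Choices} {g : (generic N).BranchNode}
    {σ : Equiv.Perm (Fin N)} (hσ : ∀ t, σ t = nextAgent c (before σ t)) :
    (generic N).Happens c g ↔ branchAt σ g.1 = g.2 := by
  constructor
  · rintro ⟨u, v, b, h, hb⟩
    obtain ⟨τ, hτ, rfl⟩ := choiceRel_iff.1 h
    obtain rfl : τ = σ := Equiv.ext fun t =>
      order_eq_of_rules_eq hτ hσ (j := N) (fun _ _ => rfl) t t.2
    exact hb
  · intro h
    exact ⟨fun _ => Classical.arbitrary _, fun _ => Classical.arbitrary _, branchAt σ,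
      choiceRel_iff.2 ⟨σ, hσ, rfl⟩, h⟩

theorem adjoint_happens_iff {c : (generic N).adjoint.Choices} {g : (generic N).BranchNode}
    {σ : Equiv.Perm (Fin N)} (hσ : ∀ t : Fin N, σ t = lastAgent c (before σ (t + 1))) :
    (generic N).adjoint.Happens c ((generic N).toAdjoint g) ↔ branchAt σ g.1 = g.2 := by
  constructor
  · rintro ⟨u, v, b, h, hb⟩
    obtain ⟨τ, hτ, rfl⟩ := adjoint_choiceRel_iff.1 h
    obtain rfl : τ = σ := Equiv.ext fun t =>
      order_eq_of_backward_rules_eq hτ hσ (j := 0) (fun _ _ => rfl) t (Nat.zero_le _)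
    exact congrArg Branch.transpose hb
  · intro h
    exact ⟨fun _ => Classical.arbitrary _, fun _ => Classical.arbitrary _,
      fun n => (branchAt σ n).transpose, adjoint_choiceRel_iff.2 ⟨σ, hσ, rfl⟩,
      congrArg Branch.transpose h⟩

/-- The order up to position `j` depends only on the choices made at the branches before position
`j`, so that a choice cannot influence what happens at its own time or before. -/
theorem branchTime_lt_of_weakParent {b g : (generic N).BranchNode}
    (h : (generic N).WeakParent b g) : branchTime b < branchTime g := by
  obtain ⟨c, c', hc, hh⟩ := h
  by_contra hle
  rw [not_lt] at hle
  apply hh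
  obtain ⟨σ, hσ⟩ := exists_order_of_rule (nextAgent_notMem c)
  obtain ⟨τ, hτ⟩ := exists_order_of_rule (nextAgent_notMem c')
  rw [happens_iff hσ, happens_iff hτ]
  obtain ⟨n, b⟩ := b
  cases n with
  | A k =>
    -- the order depends only on the choices at the internal nodes
    have hst : ∀ t, σ t = τ t := fun t => order_eq_of_rules_eq hσ hτ (j := N) (fun K _ =>
      nextAgent_congr fun t hK => hc ⟨.V t.castSucc, branchV t.castSucc K hK⟩
        (by intro he; cases congrArg Sigma.fst he)) t t.2
    rw [Equiv.ext hst]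
  | V j =>
    refine branchAt_congr_of_lt hle (order_eq_of_rules_eq hσ hτ fun K hK =>
      nextAgent_congr fun t hKt => hc ⟨.V t.castSucc, branchV t.castSucc K hKt⟩ ?_)
    intro he
    have h1 : QNode.V t.castSucc = QNode.V j := congrArg Sigma.fst he
    rw [QNode.V.injEq] at h1
    have h2 := congrArg Fin.val h1
    rw [Fin.val_castSucc] at h2
    omega

/-- In the adjoint graph, which builds the order backwards, a choice influences only what happens
strictly before its time. -/
theorem branchTime_lt_of_adjoint_weakParent {b g : (generic N).BranchNode}
    (h : (generic N).adjoint.WeakParent ((generic N).toAdjoint g) ((generic N).toAdjoint b)) :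
    branchTime b < branchTime g := by
  obtain ⟨c, c', hc, hh⟩ := h
  by_contra hle
  rw [not_lt] at hle
  apply hh
  obtain ⟨σ, hσ⟩ := exists_order_of_backward_rule (lastAgent_mem c)
  obtain ⟨τ, hτ⟩ := exists_order_of_backward_rule (lastAgent_mem c')
  rw [adjoint_happens_iff hσ, adjoint_happens_iff hτ]
  obtain ⟨n, g⟩ := g
  cases n with
  | A k =>
    -- the order depends only on the choices at the internal nodes
    have hst : ∀ t, σ t = τ t := fun t => order_eq_of_backward_rules_eq hσ hτ (j := 0) (fun K _ =>
      lastAgent_congr fun t hK => hc ⟨.V t.succ, (branchV t.succ K hK).transpose⟩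
        (by intro he; cases congrArg Sigma.fst he)) t (Nat.zero_le _)
    rw [Equiv.ext hst]
  | V j =>
    refine branchAt_congr_of_ge hle (order_eq_of_backward_rules_eq hσ hτ fun K hK =>
      lastAgent_congr fun t hKt => hc ⟨.V t.succ, (branchV t.succ K hKt).transpose⟩ ?_)
    intro he
    have h1 : QNode.V t.succ = QNode.V j := congrArg Sigma.fst he
    rw [QNode.V.injEq] at h1
    have h2 := congrArg Fin.val h1
    rw [Fin.val_succ] at h2
    omega

theorem branchTime_lt_of_branchArrow {col : RoutedGraph.ArrowColour} {b g : (generic N).BranchNode}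
    (h : (generic N).BranchArrow (nullOneDim N) col b g) : branchTime b < branchTime g := by
  cases col with
  | solid => exact branchTime_lt_of_strongParent h
  | green => exact branchTime_lt_of_weakParent h
  | red => exact branchTime_lt_of_adjoint_weakParent h

theorem isEmpty_loop_generic : IsEmpty ((generic N).Loop (nullOneDim N)) := by
  refine ⟨fun l => ?_⟩
  obtain ⟨i, hi⟩ := Finite.exists_max fun i => branchTime (l.vert i)
  exact (hi (i + 1)).not_gt (branchTime_lt_of_branchArrow (l.arrow i))

theorem valid_generic : (generic N).Valid (nullOneDim N) :=
  ⟨⟨univocal_generic, univocal_adjoint_generic⟩, fun l => isEmpty_loop_generic.elim l⟩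

end BranchGraph

/-! ### Matrices supported on a block -/

section Corner

variable {X Y Z W : Type}

/-- The matrix `T` is the matrix `M` placed in the block that the basis embeddings `f` (of the
outputs) and `g` (of the inputs) single out, and it vanishes outside of this block. -/
structure IsCorner (f : W → Y) (g : Z → X) (M : Matrix W Z ℂ) (T : Matrix Y X ℂ) : Prop where
  injective_out : Function.Injective f
  injective_in : Function.Injective g
  apply_eq : ∀ w z, T (f w) (g z) = M w z
  exists_of_ne_zero : ∀ y x, T y x ≠ 0 → ∃ w z, y = f w ∧ x = g z

namespace IsCorner

variable {f : W → Y} {g : Z → X} {M : Matrix W Z ℂ} {T : Matrix Y X ℂ}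

theorem conjTranspose (h : IsCorner f g M T) : IsCorner g f Mᴴ Tᴴ where
  injective_out := h.injective_in
  injective_in := h.injective_out
  apply_eq z w := by simp [h.apply_eq]
  exists_of_ne_zero x y hne := by
    obtain ⟨w, z, hy, hx⟩ := h.exists_of_ne_zero y x (by simpa using hne)
    exact ⟨z, w, hx, hy⟩

theorem of_mul_mul [Fintype W] [Fintype Z] {J : Matrix Y W ℂ} {J' : Matrix Z X ℂ}
    (hf : Function.Injective f) (hg : Function.Injective g)
    (hJ : ∀ y w, (y = f w → J y w = 1) ∧ (y ≠ f w → J y w = 0))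
    (hJ' : ∀ z x, (x = g z → J' z x = 1) ∧ (x ≠ g z → J' z x = 0)) :
    IsCorner f g M (J * M * J') := by
  classical
  have hJ₁ : ∀ y w, J y w = if y = f w then 1 else 0 := fun y w => by
    split_ifs with h
    exacts [(hJ y w).1 h, (hJ y w).2 h]
  have hJ₂ : ∀ z x, J' z x = if x = g z then 1 else 0 := fun z x => by
    split_ifs with h
    exacts [(hJ' z x).1 h, (hJ' z x).2 h]
  refine ⟨hf, hg, fun w z => ?_, fun y x hne => ?_⟩
  · simp [Matrix.mul_apply, hJ₁, hJ₂, hf.eq_iff, hg.eq_iff]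
  · rw [Matrix.mul_apply] at hne
    obtain ⟨z, -, hz⟩ := Finset.exists_ne_zero_of_sum_ne_zero hne
    have h1 := left_ne_zero_of_mul hz
    have h2 := right_ne_zero_of_mul hz
    rw [Matrix.mul_apply] at h1
    obtain ⟨w, -, hw⟩ := Finset.exists_ne_zero_of_sum_ne_zero h1
    have h3 := left_ne_zero_of_mul hw
    rw [hJ₁] at h3
    rw [hJ₂] at h2
    exact ⟨w, z, by by_contra h; simp [h] at h3, by by_contra h; simp [h] at h2⟩

variable {K L : Type} {r : K → L → Prop} {secX : X → K} {secY : Y → L}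

theorem follows (h : IsCorner f g M T)
    (hM : ∀ w z, M w z ≠ 0 → r (secX (g z)) (secY (f w))) : Follows r secX secY T := by
  intro y x hr
  by_contra hne
  obtain ⟨w, z, rfl, rfl⟩ := h.exists_of_ne_zero y x hne
  rw [h.apply_eq] at hne
  exact hr (hM w z hne)

/-- The Gram matrix of an isometry placed in a block is the projector onto the block of the inputs,
which is the practical input space. -/
theorem conjTranspose_mul_self [Fintype Y] [Fintype W] [DecidableEq Z] (h : IsCorner f g M T)
    (hM : IsIsometry M) (hp : ∀ x, (∃ l, r (secX x) l) ↔ x ∈ Set.range g) :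
    Tᴴ * T = pracIn r secX := by
  classical
  ext x x'
  simp only [pracIn, Matrix.diagonal_apply, hp]
  by_cases hxx : x ∈ Set.range g ∧ x' ∈ Set.range g
  · obtain ⟨⟨z, rfl⟩, ⟨z', rfl⟩⟩ := hxx
    have hsum : (Tᴴ * T) (g z) (g z') = (Mᴴ * M) z z' := by
      rw [Matrix.mul_apply, Matrix.mul_apply]
      symm
      refine Fintype.sum_of_injective f h.injective_out _ _ (fun y hy => ?_) (fun w => ?_)
      · have : T y (g z') = 0 := by
          by_contra hne
          obtain ⟨w, -, rfl, -⟩ := h.exists_of_ne_zero _ _ hne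
          exact hy ⟨w, rfl⟩
        rw [this, mul_zero]
      · simp [h.apply_eq]
    have hM' : Mᴴ * M = 1 := hM
    rw [hsum, hM', Matrix.one_apply]
    simp [h.injective_in.eq_iff]
  · have hz : (Tᴴ * T) x x' = 0 := by
      rw [Matrix.mul_apply]
      refine Finset.sum_eq_zero fun y _ => ?_
      by_contra hne
      have h1 := left_ne_zero_of_mul hne
      rw [Matrix.conjTranspose_apply, star_ne_zero] at h1
      obtain ⟨_, z, _, hz⟩ := h.exists_of_ne_zero _ _ h1
      obtain ⟨_, z', _, hz'⟩ := h.exists_of_ne_zero _ _ (right_ne_zero_of_mul hne)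
      exact hxx ⟨⟨z, hz.symm⟩, ⟨z', hz'.symm⟩⟩
    rw [hz]
    split_ifs with h1 h2
    · subst h1; exact absurd ⟨h2, h2⟩ hxx
    · rfl
    · rfl

theorem isRoutedIsometry [Fintype Y] [Fintype W] [DecidableEq Z] (h : IsCorner f g M T)
    (hM : IsIsometry M) (hf : ∀ w z, M w z ≠ 0 → r (secX (g z)) (secY (f w)))
    (hp : ∀ x, (∃ l, r (secX x) l) ↔ x ∈ Set.range g) : IsRoutedIsometry r secX secY T :=
  ⟨h.follows hf, h.conjTranspose_mul_self hM hp⟩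

theorem isRoutedUnitary [Fintype X] [Fintype Y] [Fintype Z] [Fintype W] [DecidableEq Z]
    [DecidableEq W] (h : IsCorner f g M T) (hM : IsUnitary M)
    (hf : ∀ w z, M w z ≠ 0 → r (secX (g z)) (secY (f w)))
    (hp : ∀ x, (∃ l, r (secX x) l) ↔ x ∈ Set.range g)
    (hp' : ∀ y, (∃ k, r k (secY y)) ↔ y ∈ Set.range f) : IsRoutedUnitary r secX secY T := by
  refine ⟨h.follows hf, h.conjTranspose_mul_self hM.1 hp, ?_⟩
  have := h.conjTranspose.conjTranspose_mul_self (r := fun l k => r k l) (secX := secY)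
    (by rw [IsIsometry, Matrix.conjTranspose_conjTranspose]; exact hM.2) hp'
  rw [Matrix.conjTranspose_conjTranspose] at this
  exact this

end IsCorner

theorem IsUnitary.kronecker_one {C : Type} [Fintype X] [Fintype Y] [Fintype C] [DecidableEq X]
    [DecidableEq Y] [DecidableEq C] {U : Matrix Y X ℂ} (hU : IsUnitary U) :
    IsUnitary (U ⊗ₖ (1 : Matrix C C ℂ)) := by
  constructor
  · rw [Matrix.conjTranspose_kronecker, ← Matrix.mul_kronecker_mul, hU.1]
    simp
  · rw [Matrix.conjTranspose_kronecker, ← Matrix.mul_kronecker_mul, hU.2]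
    simp

theorem IsUnitary.submatrix [Fintype X] [Fintype Y] [Fintype Z] [Fintype W] [DecidableEq X]
    [DecidableEq Y] [DecidableEq Z] [DecidableEq W] {U : Matrix Y X ℂ} (hU : IsUnitary U)
    (e : W ≃ Y) (e' : Z ≃ X) : IsUnitary (U.submatrix e e') := by
  constructor
  · rw [Matrix.conjTranspose_submatrix, Matrix.submatrix_mul_equiv, hU.1,
      Matrix.submatrix_one_equiv]
  · rw [Matrix.conjTranspose_submatrix, Matrix.submatrix_mul_equiv, hU.2,
      Matrix.submatrix_one_equiv]

end Corner

/-! ### Basis vectors of the practical spaces -/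

section Wires

variable {m : ℕ} {S : Spaces m}

theorem toAVec_inj {t k : Fin (m + 1)} {K K' : QArr.Subs t k} {i i' : S.AI} {a a' : S.α t} :
    toAVec K i a = toAVec K' i' a' ↔ K = K' ∧ i = i' ∧ a = a' := by
  constructor
  · intro h
    obtain ⟨h1, h2⟩ := Sigma.mk.inj h
    obtain rfl := Option.some.inj h1
    have := Prod.mk.inj (eq_of_heq h2)
    exact ⟨rfl, this⟩
  · rintro ⟨rfl, rfl, rfl⟩
    rfl

theorem fromAVec_inj {t k : Fin (m + 1)} {K K' : QArr.Subs t k} {o o' : S.AO} {a a' : S.α t} :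
    fromAVec K o a = fromAVec K' o' a' ↔ K = K' ∧ o = o' ∧ a = a' := by
  constructor
  · intro h
    obtain ⟨h1, h2⟩ := Sigma.mk.inj h
    obtain rfl := Option.some.inj h1
    have := Prod.mk.inj (eq_of_heq h2)
    exact ⟨rfl, this⟩
  · rintro ⟨rfl, rfl, rfl⟩
    rfl

theorem toAVec_ne_toANull {t k : Fin (m + 1)} (K : QArr.Subs t k) (i : S.AI) (a : S.α t) :
    toAVec K i a ≠ toANull t k := fun h => Option.some_ne_none _ (Sigma.mk.inj h).1

theorem fromAVec_ne_fromANull {t k : Fin (m + 1)} (K : QArr.Subs t k) (o : S.AO) (a : S.α t) :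
    fromAVec K o a ≠ fromANull t k := fun h => Option.some_ne_none _ (Sigma.mk.inj h).1

theorem eq_toANull {t k : Fin (m + 1)} {w : (dims S).Wire (.toA t k)}
    (h : w.1 = (none : Option (QArr.Subs t k))) : w = toANull t k := by
  obtain ⟨K, v⟩ := w
  dsimp only at h
  subst h
  rfl

theorem eq_fromANull {t k : Fin (m + 1)} {w : (dims S).Wire (.fromA t k)}
    (h : w.1 = (none : Option (QArr.Subs t k))) : w = fromANull t k := by
  obtain ⟨K, v⟩ := w
  dsimp only at h
  subst h
  rfl

theorem exists_eq_toAVec {t k : Fin (m + 1)} {w : (dims S).Wire (.toA t k)} {K : QArr.Subs t k}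
    (h : w.1 = (some K : Option (QArr.Subs t k))) : ∃ i a, w = toAVec K i a := by
  obtain ⟨K, v⟩ := w
  dsimp only at h
  subst h
  exact ⟨v.1, v.2, rfl⟩

theorem exists_eq_fromAVec {t k : Fin (m + 1)} {w : (dims S).Wire (.fromA t k)}
    {K : QArr.Subs t k} (h : w.1 = (some K : Option (QArr.Subs t k))) :
    ∃ o a, w = fromAVec K o a := by
  obtain ⟨K, v⟩ := w
  dsimp only at h
  subst h
  exact ⟨v.1, v.2, rfl⟩

variable (S)

/-- The basis vectors of the practical input space of `A_k`. -/
def encInA (k : Fin (m + 1)) (z : S.AI × CtrlA S k) : (dims S).InBasis (.A k)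
  | ⟨.toA t k', h⟩ => by
      cases h
      exact Function.update (fun t => toANull t k) z.2.1 (toAVec z.2.2.2 z.1 z.2.2.1) t
  | ⟨.past, h⟩ => nomatch h
  | ⟨.future, h⟩ => nomatch h
  | ⟨.fromA _ _, h⟩ => nomatch h

/-- The basis vectors of the practical output space of `A_k`. -/
def encOutA (k : Fin (m + 1)) (z : S.AO × CtrlA S k) : (dims S).OutBasis (.A k)
  | ⟨.fromA t k', h⟩ => by
      cases h
      exact Function.update (fun t => fromANull t k) z.2.1 (fromAVec z.2.2.2 z.1 z.2.2.1) t
  | ⟨.past, h⟩ => nomatch h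
  | ⟨.future, h⟩ => nomatch h
  | ⟨.toA _ _, h⟩ => nomatch h

/-- The basis vectors of the practical input space of `V_{n+1}`, `n = t + 1`. -/
def encInV (t : Fin (m + 1)) (z : S.AO × S.α t × Ctrl (m + 1) t) :
    (dims S).InBasis (.V t.succ)
  | ⟨.fromA t' k, h⟩ => by
      obtain rfl : t' = t := Fin.succ_injective _ (QNode.V.inj (Option.some.inj h))
      exact Function.update (fun k => fromANull t' k) z.2.2.1.2
        (fromAVec ⟨z.2.2.1.1, z.2.2.2⟩ z.1 z.2.1) k
  | ⟨.past, h⟩ => (Fin.succ_ne_zero t (QNode.V.inj (Option.some.inj h)).symm).elim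
  | ⟨.future, h⟩ => nomatch h
  | ⟨.toA _ _, h⟩ => nomatch h

/-- The basis vectors of the practical output space of `V_n`, `n = t + 1`. -/
def encOutV (t : Fin (m + 1)) (z : S.AI × S.α t × Ctrl (m + 1) t) :
    (dims S).OutBasis (.V t.castSucc)
  | ⟨.toA t' k, h⟩ => by
      obtain rfl : t' = t := Fin.castSucc_injective _ (QNode.V.inj (Option.some.inj h))
      exact Function.update (fun k => toANull t' k) z.2.2.1.2
        (toAVec ⟨z.2.2.1.1, z.2.2.2⟩ z.1 z.2.1) k
  | ⟨.future, h⟩ =>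
      ((Fin.castSucc_lt_last t).ne (QNode.V.inj (Option.some.inj h)).symm).elim
  | ⟨.past, h⟩ => nomatch h
  | ⟨.fromA _ _, h⟩ => nomatch h

/-- The basis vectors of the input space of `V_1`. -/
def encInFirst (p : S.P) : (dims S).InBasis (.V 0)
  | ⟨.past, _⟩ => pastVec p
  | ⟨.fromA t _, h⟩ => (Fin.succ_ne_zero t (QNode.V.inj (Option.some.inj h))).elim
  | ⟨.future, h⟩ => nomatch h
  | ⟨.toA _ _, h⟩ => nomatch h

/-- The basis vectors of the output space of `V_{N+1}`. -/
def encOutLast (f : S.F) : (dims S).OutBasis (.V (Fin.last (m + 1)))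
  | ⟨.future, _⟩ => futureVec f
  | ⟨.toA t _, h⟩ => ((Fin.castSucc_lt_last t).ne (QNode.V.inj (Option.some.inj h))).elim
  | ⟨.past, h⟩ => nomatch h
  | ⟨.fromA _ _, h⟩ => nomatch h

variable {S}

theorem eq_encInA_iff {k : Fin (m + 1)} {x : (dims S).InBasis (.A k)} {z : S.AI × CtrlA S k} :
    x = encInA S k z ↔ x (inA z.2.1 k) = toAVec z.2.2.2 z.1 z.2.2.1 ∧
      ∀ t', t' ≠ z.2.1 → x (inA t' k) = toANull t' k := by
  have h : ∀ t, encInA S k z (inA t k) =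
      Function.update (fun t => toANull t k) z.2.1 (toAVec z.2.2.2 z.1 z.2.2.1) t := fun _ => rfl
  constructor
  · rintro rfl
    refine ⟨by rw [h, Function.update_self], fun t' ht' => by rw [h, Function.update_of_ne ht']⟩
  · rintro ⟨h1, h2⟩
    funext ⟨a, ha⟩
    cases a with
    | toA t k' =>
      cases ha
      refine Eq.trans ?_ (h t).symm
      by_cases ht : t = z.2.1
      · subst ht
        rw [Function.update_self]
        exact h1
      · rw [Function.update_of_ne ht]
        exact h2 t ht
    | past => cases ha
    | future => cases ha
    | fromA => cases ha

theorem eq_encOutA_iff {k : Fin (m + 1)} {y : (dims S).OutBasis (.A k)} {z : S.AO × CtrlA S k} :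
    y = encOutA S k z ↔ y (outA z.2.1 k) = fromAVec z.2.2.2 z.1 z.2.2.1 ∧
      ∀ t', t' ≠ z.2.1 → y (outA t' k) = fromANull t' k := by
  have h : ∀ t, encOutA S k z (outA t k) =
      Function.update (fun t => fromANull t k) z.2.1 (fromAVec z.2.2.2 z.1 z.2.2.1) t :=
    fun _ => rfl
  constructor
  · rintro rfl
    refine ⟨by rw [h, Function.update_self], fun t' ht' => by rw [h, Function.update_of_ne ht']⟩
  · rintro ⟨h1, h2⟩
    funext ⟨a, ha⟩
    cases a with
    | fromA t k' =>
      cases ha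
      refine Eq.trans ?_ (h t).symm
      by_cases ht : t = z.2.1
      · subst ht
        rw [Function.update_self]
        exact h1
      · rw [Function.update_of_ne ht]
        exact h2 t ht
    | past => cases ha
    | future => cases ha
    | toA => cases ha

theorem eq_encInV_iff {t : Fin (m + 1)} {x : (dims S).InBasis (.V t.succ)}
    {z : S.AO × S.α t × Ctrl (m + 1) t} :
    x = encInV S t z ↔ x (inV t z.2.2.1.2) = fromAVec ⟨z.2.2.1.1, z.2.2.2⟩ z.1 z.2.1 ∧
      ∀ k', k' ≠ z.2.2.1.2 → x (inV t k') = fromANull t k' := by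
  have h : ∀ k, encInV S t z (inV t k) = Function.update (fun k => fromANull t k) z.2.2.1.2
      (fromAVec ⟨z.2.2.1.1, z.2.2.2⟩ z.1 z.2.1) k := fun _ => rfl
  constructor
  · rintro rfl
    refine ⟨by rw [h, Function.update_self], fun t' ht' => by rw [h, Function.update_of_ne ht']⟩
  · rintro ⟨h1, h2⟩
    funext ⟨a, ha⟩
    cases a with
    | fromA t' k =>
      obtain rfl : t' = t := Fin.succ_injective _ (QNode.V.inj (Option.some.inj ha))
      refine Eq.trans ?_ (h k).symm
      by_cases hk : k = z.2.2.1.2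
      · subst hk
        rw [Function.update_self]
        exact h1
      · rw [Function.update_of_ne hk]
        exact h2 k hk
    | past => exact (Fin.succ_ne_zero t (QNode.V.inj (Option.some.inj ha)).symm).elim
    | future => cases ha
    | toA => cases ha

theorem eq_encOutV_iff {t : Fin (m + 1)} {y : (dims S).OutBasis (.V t.castSucc)}
    {z : S.AI × S.α t × Ctrl (m + 1) t} :
    y = encOutV S t z ↔ y (outV t z.2.2.1.2) = toAVec ⟨z.2.2.1.1, z.2.2.2⟩ z.1 z.2.1 ∧
      ∀ k', k' ≠ z.2.2.1.2 → y (outV t k') = toANull t k' := by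
  have h : ∀ k, encOutV S t z (outV t k) = Function.update (fun k => toANull t k) z.2.2.1.2
      (toAVec ⟨z.2.2.1.1, z.2.2.2⟩ z.1 z.2.1) k := fun _ => rfl
  constructor
  · rintro rfl
    refine ⟨by rw [h, Function.update_self], fun t' ht' => by rw [h, Function.update_of_ne ht']⟩
  · rintro ⟨h1, h2⟩
    funext ⟨a, ha⟩
    cases a with
    | toA t' k =>
      obtain rfl : t' = t := Fin.castSucc_injective _ (QNode.V.inj (Option.some.inj ha))
      refine Eq.trans ?_ (h k).symm
      by_cases hk : k = z.2.2.1.2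
      · subst hk
        rw [Function.update_self]
        exact h1
      · rw [Function.update_of_ne hk]
        exact h2 k hk
    | future => exact ((Fin.castSucc_lt_last t).ne (QNode.V.inj (Option.some.inj ha)).symm).elim
    | past => cases ha
    | fromA => cases ha

theorem eq_encInFirst_iff {x : (dims S).InBasis (.V 0)} {p : S.P} :
    x = encInFirst S p ↔ x ⟨.past, rfl⟩ = pastVec p := by
  constructor
  · rintro rfl
    rfl
  · intro h1
    funext ⟨a, ha⟩
    cases a with
    | past => exact h1
    | fromA t k => exact (Fin.succ_ne_zero t (QNode.V.inj (Option.some.inj ha))).elim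
    | future => cases ha
    | toA => cases ha

theorem eq_encOutLast_iff {y : (dims S).OutBasis (.V (Fin.last (m + 1)))} {f : S.F} :
    y = encOutLast S f ↔ y ⟨.future, rfl⟩ = futureVec f := by
  constructor
  · rintro rfl
    rfl
  · intro h1
    funext ⟨a, ha⟩
    cases a with
    | future => exact h1
    | toA t k => exact ((Fin.castSucc_lt_last t).ne (QNode.V.inj (Option.some.inj ha))).elim
    | past => cases ha
    | fromA => cases ha

theorem encInA_injective (k : Fin (m + 1)) : Function.Injective (encInA S k) := by
  rintro ⟨i, t, a, K⟩ ⟨i', t', a', K'⟩ h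
  obtain ⟨h1, h2⟩ := eq_encInA_iff.1 (rfl : encInA S k ⟨i, t, a, K⟩ = _)
  rw [h] at h1
  obtain ⟨h3, h4⟩ := eq_encInA_iff.1 (rfl : encInA S k ⟨i', t', a', K'⟩ = _)
  dsimp only at h1 h3 h4
  obtain rfl : t = t' := by
    by_contra hne
    exact toAVec_ne_toANull _ _ _ (h1.symm.trans (h4 t hne))
  obtain ⟨rfl, rfl, rfl⟩ := toAVec_inj.1 (h1.symm.trans h3)
  rfl

theorem encOutA_injective (k : Fin (m + 1)) : Function.Injective (encOutA S k) := by
  rintro ⟨i, t, a, K⟩ ⟨i', t', a', K'⟩ h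
  obtain ⟨h1, h2⟩ := eq_encOutA_iff.1 (rfl : encOutA S k ⟨i, t, a, K⟩ = _)
  rw [h] at h1
  obtain ⟨h3, h4⟩ := eq_encOutA_iff.1 (rfl : encOutA S k ⟨i', t', a', K'⟩ = _)
  dsimp only at h1 h3 h4
  obtain rfl : t = t' := by
    by_contra hne
    exact fromAVec_ne_fromANull _ _ _ (h1.symm.trans (h4 t hne))
  obtain ⟨rfl, rfl, rfl⟩ := fromAVec_inj.1 (h1.symm.trans h3)
  rfl

theorem encInV_injective (t : Fin (m + 1)) : Function.Injective (encInV S t) := by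
  rintro ⟨i, a, ⟨K, k⟩, hK⟩ ⟨i', a', ⟨K', k'⟩, hK'⟩ h
  obtain ⟨h1, h2⟩ := eq_encInV_iff.1 (rfl : encInV S t ⟨i, a, ⟨K, k⟩, hK⟩ = _)
  rw [h] at h1
  obtain ⟨h3, h4⟩ := eq_encInV_iff.1 (rfl : encInV S t ⟨i', a', ⟨K', k'⟩, hK'⟩ = _)
  dsimp only at h1 h3 h4
  obtain rfl : k = k' := by
    by_contra hne
    exact fromAVec_ne_fromANull _ _ _ (h1.symm.trans (h4 k hne))
  obtain ⟨h5, rfl, rfl⟩ := fromAVec_inj.1 (h1.symm.trans h3)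
  obtain rfl := congrArg Subtype.val h5
  rfl

theorem encOutV_injective (t : Fin (m + 1)) : Function.Injective (encOutV S t) := by
  rintro ⟨i, a, ⟨K, k⟩, hK⟩ ⟨i', a', ⟨K', k'⟩, hK'⟩ h
  obtain ⟨h1, h2⟩ := eq_encOutV_iff.1 (rfl : encOutV S t ⟨i, a, ⟨K, k⟩, hK⟩ = _)
  rw [h] at h1
  obtain ⟨h3, h4⟩ := eq_encOutV_iff.1 (rfl : encOutV S t ⟨i', a', ⟨K', k'⟩, hK'⟩ = _)
  dsimp only at h1 h3 h4
  obtain rfl : k = k' := by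
    by_contra hne
    exact toAVec_ne_toANull _ _ _ (h1.symm.trans (h4 k hne))
  obtain ⟨h5, rfl, rfl⟩ := toAVec_inj.1 (h1.symm.trans h3)
  obtain rfl := congrArg Subtype.val h5
  rfl

theorem encInFirst_injective : Function.Injective (encInFirst S) := by
  intro p p' h
  have h1 : (pastVec p : (dims S).Wire .past) = pastVec p' := congrFun h ⟨.past, rfl⟩
  exact eq_of_heq (Sigma.mk.inj h1).2

theorem encOutLast_injective : Function.Injective (encOutLast S) := by
  intro p p' h
  have h1 : (futureVec p : (dims S).Wire .future) = futureVec p' := congrFun h ⟨.future, rfl⟩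
  exact eq_of_heq (Sigma.mk.inj h1).2

end Wires

/-! ### Practical spaces and routes -/

section Sectors

variable {m : ℕ} {S : Spaces m}

theorem inAt_encInA (k : Fin (m + 1)) (z : S.AI × CtrlA S k) :
    InAt ⟨z.2.1, z.2.2.2⟩ ((dims S).inSector (.A k) (encInA S k z)) := by
  obtain ⟨h1, h2⟩ := eq_encInA_iff.1 (rfl : encInA S k z = _)
  exact ⟨congrArg Sigma.fst h1, fun t ht => congrArg Sigma.fst (h2 t ht)⟩

theorem outAt_encOutA (k : Fin (m + 1)) (z : S.AO × CtrlA S k) :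
    OutAt ⟨z.2.1, z.2.2.2⟩ ((dims S).outSector (.A k) (encOutA S k z)) := by
  obtain ⟨h1, h2⟩ := eq_encOutA_iff.1 (rfl : encOutA S k z = _)
  exact ⟨congrArg Sigma.fst h1, fun t ht => congrArg Sigma.fst (h2 t ht)⟩

theorem mem_range_encInA {k : Fin (m + 1)} {K : Σ t, QArr.Subs t k} {x : (dims S).InBasis (.A k)}
    (h : InAt K ((dims S).inSector (.A k) x)) : x ∈ Set.range (encInA S k) := by
  obtain ⟨i, a, hx⟩ := exists_eq_toAVec (w := x (inA K.1 k)) h.1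
  exact ⟨(i, ⟨K.1, a, K.2⟩), (eq_encInA_iff.2 ⟨hx, fun t ht => eq_toANull (h.2 t ht)⟩).symm⟩

theorem mem_range_encOutA {k : Fin (m + 1)} {K : Σ t, QArr.Subs t k}
    {y : (dims S).OutBasis (.A k)} (h : OutAt K ((dims S).outSector (.A k) y)) :
    y ∈ Set.range (encOutA S k) := by
  obtain ⟨i, a, hx⟩ := exists_eq_fromAVec (w := y (outA K.1 k)) h.1
  exact ⟨(i, ⟨K.1, a, K.2⟩), (eq_encOutA_iff.2 ⟨hx, fun t ht => eq_fromANull (h.2 t ht)⟩).symm⟩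

theorem practicalIn_A (k : Fin (m + 1)) (x : (dims S).InBasis (.A k)) :
    (∃ l, genericRoute (m + 1) (.A k) ((dims S).inSector (.A k) x) l) ↔
      x ∈ Set.range (encInA S k) := by
  refine ((blocksA k).exists_rel_iff _).trans ⟨fun ⟨K, hK⟩ => mem_range_encInA hK, ?_⟩
  rintro ⟨z, rfl⟩
  exact ⟨_, inAt_encInA k z⟩

theorem practicalOut_A (k : Fin (m + 1)) (y : (dims S).OutBasis (.A k)) :
    (∃ x, genericRoute (m + 1) (.A k) x ((dims S).outSector (.A k) y)) ↔
      y ∈ Set.range (encOutA S k) := by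
  refine ((blocksA k).transpose.exists_rel_iff _).trans ⟨fun ⟨K, hK⟩ => mem_range_encOutA hK, ?_⟩
  rintro ⟨z, rfl⟩
  exact ⟨_, outAt_encOutA k z⟩

theorem arrived_encInV (t : Fin (m + 1)) (z : S.AO × S.α t × Ctrl (m + 1) t) :
    Arrived t.succ z.2.2.1.1 ((dims S).inSector (.V t.succ) (encInV S t z)) := by
  intro s hs
  obtain rfl := Fin.succ_injective _ hs
  obtain ⟨h1, h2⟩ := eq_encInV_iff.1 (rfl : encInV S s z = _)
  exact ⟨_, _, congrArg Sigma.fst h1, rfl, fun k hk => congrArg Sigma.fst (h2 k hk)⟩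

theorem departed_encOutV (t : Fin (m + 1)) (z : S.AI × S.α t × Ctrl (m + 1) t)
    {K : Finset (Fin (m + 1))} (hK : z.2.2.1.1 = insert z.2.2.1.2 K) :
    Departed t.castSucc K ((dims S).outSector (.V t.castSucc) (encOutV S t z)) := by
  intro s hs
  obtain rfl := Fin.castSucc_injective _ hs
  obtain ⟨h1, h2⟩ := eq_encOutV_iff.1 (rfl : encOutV S s z = _)
  exact ⟨_, _, congrArg Sigma.fst h1, hK, fun k hk => congrArg Sigma.fst (h2 k hk)⟩

theorem practicalIn_V (t : Fin (m + 1)) (x : (dims S).InBasis (.V t.succ)) :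
    (∃ l, genericRoute (m + 1) (.V t.succ) ((dims S).inSector (.V t.succ) x) l) ↔
      x ∈ Set.range (encInV S t) := by
  refine ((blocksV t.succ).exists_rel_iff _).trans ⟨?_, ?_⟩
  · rintro ⟨K, hK⟩
    obtain ⟨k, L, hL, -, hn⟩ := hK t rfl
    obtain ⟨o, a, hx⟩ := exists_eq_fromAVec (w := x (inV t k)) hL
    exact ⟨(o, a, ⟨(L.1, k), L.2⟩),
      (eq_encInV_iff.2 ⟨hx, fun k' hk' => eq_fromANull (hn k' hk')⟩).symm⟩
  · rintro ⟨z, rfl⟩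
    exact ⟨⟨z.2.2.1.1, by rw [z.2.2.2.1]; simp⟩, arrived_encInV t z⟩

theorem mem_range_encInFirst (x : (dims S).InBasis (.V 0)) : x ∈ Set.range (encInFirst S) :=
  ⟨(x ⟨.past, rfl⟩).2, (eq_encInFirst_iff.2 rfl).symm⟩

theorem practicalIn_first (x : (dims S).InBasis (.V 0)) :
    (∃ l, genericRoute (m + 1) (.V 0) ((dims S).inSector (.V 0) x) l) ↔
      x ∈ Set.range (encInFirst S) := by
  refine ((blocksV 0).exists_rel_iff _).trans (iff_of_true ?_ (mem_range_encInFirst x))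
  exact ⟨⟨∅, by simp⟩, fun s hs => absurd hs (Fin.succ_ne_zero s)⟩

end Sectors

/-! ### The maps filling the nodes -/

section Fillings

variable {m : ℕ} {S : Spaces m}

theorem isCorner_fillA (k : Fin (m + 1)) (A : Matrix S.AO S.AI ℂ) :
    IsCorner (encOutA S k) (encInA S k) (A ⊗ₖ (1 : Matrix (CtrlA S k) (CtrlA S k) ℂ))
      (fillA S k A) :=
  IsCorner.of_mul_mul (encOutA_injective k) (encInA_injective k)
    (fun _ _ => ⟨fun h => if_pos (eq_encOutA_iff.1 h), fun h => if_neg (mt eq_encOutA_iff.2 h)⟩)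
    (fun _ _ => ⟨fun h => if_pos (eq_encInA_iff.1 h), fun h => if_neg (mt eq_encInA_iff.2 h)⟩)

theorem isCorner_fillV_zero (Q : QCQC S) :
    IsCorner (encOutV S 0) (encInFirst S) Q.tildeFirst (fillV Q 0) :=
  IsCorner.of_mul_mul (encOutV_injective 0) encInFirst_injective
    (fun _ _ => ⟨fun h => if_pos (eq_encOutV_iff.1 h), fun h => if_neg (mt eq_encOutV_iff.2 h)⟩)
    (fun _ _ => ⟨fun h => if_pos (eq_encInFirst_iff.1 h), fun h => if_neg (mt eq_encInFirst_iff.2 h)⟩)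

theorem isCorner_fillV_succ_castSucc (Q : QCQC S) (s : Fin m) :
    IsCorner (encOutV S s.succ) (encInV S s.castSucc) (Q.tildeMid s)
      (fillV Q s.castSucc.succ) := by
  have : fillV Q s.castSucc.succ = jOutV S s.succ * Q.tildeMid s * jInV S s.castSucc := by
    exact Fin.lastCases_castSucc (motive := fun i : Fin (m + 1) =>
      Matrix ((dims S).OutBasis (.V i.succ)) ((dims S).InBasis (.V i.succ)) ℂ)
      (last := jOutLast S * Q.tildeLast * jInV S (Fin.last m))
      (cast := fun s => jOutV S s.succ * Q.tildeMid s * jInV S s.castSucc) s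
  rw [this]
  exact IsCorner.of_mul_mul (encOutV_injective _) (encInV_injective _)
    (fun _ _ => ⟨fun h => if_pos (eq_encOutV_iff.1 h), fun h => if_neg (mt eq_encOutV_iff.2 h)⟩)
    (fun _ _ => ⟨fun h => if_pos (eq_encInV_iff.1 h), fun h => if_neg (mt eq_encInV_iff.2 h)⟩)

theorem isCorner_fillV_last (Q : QCQC S) :
    IsCorner (encOutLast S) (encInV S (Fin.last m)) Q.tildeLast (fillV Q (Fin.last m).succ) := by
  have : fillV Q (Fin.last m).succ = jOutLast S * Q.tildeLast * jInV S (Fin.last m) := by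
    exact Fin.lastCases_last (motive := fun i : Fin (m + 1) =>
      Matrix ((dims S).OutBasis (.V i.succ)) ((dims S).InBasis (.V i.succ)) ℂ)
      (last := jOutLast S * Q.tildeLast * jInV S (Fin.last m))
      (cast := fun s => jOutV S s.succ * Q.tildeMid s * jInV S s.castSucc)
  rw [this]
  exact IsCorner.of_mul_mul encOutLast_injective (encInV_injective _)
    (fun _ _ => ⟨fun h => if_pos (eq_encOutLast_iff.1 h), fun h => if_neg (mt eq_encOutLast_iff.2 h)⟩)
    (fun _ _ => ⟨fun h => if_pos (eq_encInV_iff.1 h), fun h => if_neg (mt eq_encInV_iff.2 h)⟩)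

theorem route_encA {k : Fin (m + 1)} {z : S.AI × CtrlA S k} {w : S.AO × CtrlA S k}
    (h : w.2 = z.2) : genericRoute (m + 1) (.A k) ((dims S).inSector (.A k) (encInA S k z))
      ((dims S).outSector (.A k) (encOutA S k w)) := by
  refine ((blocksA k).rel_iff _ _).2 ⟨_, inAt_encInA k z, ?_⟩
  have := outAt_encOutA k w
  rwa [h] at this

theorem follows_fillA (k : Fin (m + 1)) (A : Matrix S.AO S.AI ℂ) :
    Follows (genericRoute (m + 1) (.A k)) ((dims S).inSector (.A k)) ((dims S).outSector (.A k))
      (fillA S k A) := by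
  refine (isCorner_fillA k A).follows fun w z h => route_encA ?_
  by_contra hne
  rw [Matrix.kronecker_apply, Matrix.one_apply_ne hne, mul_zero] at h
  exact h rfl

/-- The agent's operation, in parallel with the identity on the ancilla and the control, is
unitary between the practical spaces of `A_k`, also in the presence of an ancilla of the agent. -/
theorem isRoutedSuperunitary_fillA (k : Fin (m + 1)) :
    IsRoutedSuperunitary (genericRoute (m + 1) (.A k)) ((dims S).inSector (.A k))
      ((dims S).outSector (.A k)) (fun A : Unit → Matrix S.AO S.AI ℂ => fillA S k (A ())) := by
  intro ancIn ancOut _ _ _ _ U hU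
  classical
  -- with ancillas, the block is the given unitary tensored with the identity on the control
  let e : (S.AO × CtrlA S k) × (∀ s, ancOut s) ≃ (S.AO × ancOut ()) × CtrlA S k :=
    { toFun := fun y => ((y.1.1, y.2 ()), y.1.2)
      invFun := fun y => ((y.1.1, y.2), fun _ => y.1.2)
      left_inv := fun _ => rfl
      right_inv := fun _ => rfl }
  let e' : (S.AI × CtrlA S k) × (∀ s, ancIn s) ≃ (S.AI × ancIn ()) × CtrlA S k :=
    { toFun := fun y => ((y.1.1, y.2 ()), y.1.2)
      invFun := fun y => ((y.1.1, y.2), fun _ => y.1.2)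
      left_inv := fun _ => rfl
      right_inv := fun _ => rfl }
  have hc : IsCorner (Prod.map (encOutA S k) (id : (∀ s, ancOut s) → _))
      (Prod.map (encInA S k) (id : (∀ s, ancIn s) → _))
      ((U () ⊗ₖ (1 : Matrix (CtrlA S k) (CtrlA S k) ℂ)).submatrix e e')
      (plugWithAncillas (fun A : Unit → Matrix S.AO S.AI ℂ => fillA S k (A ())) U) := by
    refine ⟨(encOutA_injective k).prodMap Function.injective_id,
      (encInA_injective k).prodMap Function.injective_id, fun w z => ?_, fun y x h => ?_⟩
    · exact (isCorner_fillA k _).apply_eq w.1 z.1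
    · obtain ⟨w, z, hw, hz⟩ := (isCorner_fillA k _).exists_of_ne_zero _ _ h
      exact ⟨(w, y.2), (z, x.2), Prod.ext hw rfl, Prod.ext hz rfl⟩
  refine hc.isRoutedUnitary (((hU ()).kronecker_one).submatrix e e') (fun w z h => ?_)
    (fun x => ?_) (fun y => ?_)
  · refine route_encA ?_
    by_contra hne
    have hne' : (e w).2 ≠ (e' z).2 := hne
    rw [Matrix.submatrix_apply, Matrix.kronecker_apply, Matrix.one_apply_ne hne', mul_zero] at h
    exact h rfl
  · rw [practicalIn_A, Set.range_prodMap]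
    simp
  · rw [practicalOut_A, Set.range_prodMap]
    simp

theorem isRoutedIsometry_fillV (Q : QCQC S) (j : Fin (m + 2)) :
    IsRoutedIsometry (genericRoute (m + 1) (.V j)) ((dims S).inSector (.V j))
      ((dims S).outSector (.V j)) (fillV Q j) := by
  induction j using Fin.cases with
  | zero =>
    refine (isCorner_fillV_zero Q).isRoutedIsometry Q.isometry_first (fun w z _ => ?_)
      practicalIn_first
    refine ((blocksV 0).rel_iff _ _).2 ⟨⟨∅, by simp⟩,
      fun s hs => absurd hs (Fin.succ_ne_zero s), departed_encOutV 0 w ?_⟩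
    obtain ⟨a, ha⟩ := Finset.card_eq_one.1 w.2.2.2.1
    have hw := w.2.2.2.2
    rw [ha, Finset.mem_singleton] at hw
    rw [ha, hw]
    rfl
  | succ t =>
    induction t using Fin.lastCases with
    | last =>
      refine (isCorner_fillV_last Q).isRoutedIsometry Q.isometry_last (fun w z _ => ?_)
        (practicalIn_V _)
      exact ((blocksV (Fin.last (m + 1))).rel_iff _ _).2 ⟨⟨z.2.2.1.1, z.2.2.2.1⟩,
        arrived_encInV _ z, fun t ht => absurd ht (Fin.castSucc_lt_last t).ne⟩
    | cast s =>
      refine (isCorner_fillV_succ_castSucc Q s).isRoutedIsometry (Q.isometry_mid s)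
        (fun w z h => ?_) (practicalIn_V _)
      refine ((blocksV s.castSucc.succ).rel_iff _ _).2 ⟨⟨z.2.2.1.1, z.2.2.2.1⟩,
        arrived_encInV _ z, departed_encOutV s.succ w ?_⟩
      by_contra hne
      rw [InternalOps.tildeMid, if_neg hne] at h
      exact h rfl

theorem isFleshingOut_filling (Q : QCQC S) : IsFleshingOut (G := generic (m + 1)) (filling Q) := by
  intro n ops
  cases n with
  | A k => exact follows_fillA k (ops ())
  | V j => exact (isRoutedIsometry_fillV Q j).1

end Fillings

/-! ### Contraction along the arrows -/

section Contraction

variable {m : ℕ} {S : Spaces m}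

theorem visited_eq_before (σ : Equiv.Perm (Fin (m + 1))) (t : Fin (m + 1)) :
    QCQC.visited σ t = before σ (t + 1) := by
  ext k
  simp only [QCQC.visited, Finset.mem_image, Finset.mem_filter, Finset.mem_univ, true_and,
    mem_before, Nat.lt_succ_iff]
  constructor
  · rintro ⟨s, hs, rfl⟩
    simpa using hs
  · exact fun h => ⟨σ.symm k, h, by simp⟩

theorem prod_qNode {N : ℕ} (F : QNode N → ℂ) :
    ∏ n, F n = (∏ k, F (.A k)) * ∏ j, F (.V j) := by
  let e : Fin N ⊕ Fin (N + 1) ≃ QNode N :=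
    { toFun := Sum.elim .A .V
      invFun := fun n => match n with
        | .A k => .inl k
        | .V j => .inr j
      left_inv := by rintro (k | j) <;> rfl
      right_inv := by rintro (k | j) <;> rfl }
  rw [← e.prod_comp, Fintype.prod_sum_type]
  rfl

/-- The agents in the first positions of the order `σ`, up to position `t`, as an index value. -/
abbrev visitedSubs (σ : Equiv.Perm (Fin (m + 1))) (t : Fin (m + 1)) : QArr.Subs t (σ t) :=
  ⟨before σ (t + 1), card_before σ (Nat.succ_le_of_lt t.2), apply_mem_before σ t⟩

variable (S) in
/-- The data of a nonzero term of the contraction: the order of the agents, and basis vectors for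
the agents' input and output spaces and the ancillary spaces. -/
abbrev History : Type :=
  Equiv.Perm (Fin (m + 1)) × (Fin (m + 1) → S.AI) × (Fin (m + 1) → S.AO) × ∀ t, S.α t

/-- The basis vectors of all the wires for given past and future and a given history. -/
def wires (p : S.P) (f : S.F) (d : History S) : ∀ a : QArr (m + 1), (dims S).Wire a
  | .past => pastVec p
  | .future => futureVec f
  | .toA t k => if h : d.1 t = k then
      toAVec ⟨before d.1 (t + 1), card_before d.1 (Nat.succ_le_of_lt t.2),
        h ▸ apply_mem_before d.1 t⟩ (d.2.1 k) (d.2.2.2 t) else toANull t k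
  | .fromA t k => if h : d.1 t = k then
      fromAVec ⟨before d.1 (t + 1), card_before d.1 (Nat.succ_le_of_lt t.2),
        h ▸ apply_mem_before d.1 t⟩ (d.2.2.1 k) (d.2.2.2 t) else fromANull t k

variable {p : S.P} {f : S.F}

theorem wires_toA_self (d : History S) (t : Fin (m + 1)) :
    wires p f d (.toA t (d.1 t)) = toAVec (visitedSubs d.1 t) (d.2.1 (d.1 t)) (d.2.2.2 t) :=
  dif_pos rfl

theorem wires_toA_of_ne {d : History S} {t k : Fin (m + 1)} (h : d.1 t ≠ k) :
    wires p f d (.toA t k) = toANull t k := dif_neg h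

theorem wires_fromA_self (d : History S) (t : Fin (m + 1)) :
    wires p f d (.fromA t (d.1 t)) = fromAVec (visitedSubs d.1 t) (d.2.2.1 (d.1 t)) (d.2.2.2 t) :=
  dif_pos rfl

theorem wires_fromA_of_ne {d : History S} {t k : Fin (m + 1)} (h : d.1 t ≠ k) :
    wires p f d (.fromA t k) = fromANull t k := dif_neg h

theorem wires_injective : Function.Injective (wires (S := S) p f) := by
  intro d d' h
  have h1 : d.1 = d'.1 := by
    ext t : 1
    by_contra hne
    have h2 := congrFun h (.toA t (d.1 t))
    rw [wires_toA_self, wires_toA_of_ne (Ne.symm hne)] at h2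
    exact toAVec_ne_toANull _ _ _ h2
  obtain ⟨σ, i, o, a⟩ := d
  obtain ⟨σ', i', o', a'⟩ := d'
  dsimp only at h1
  subst h1
  have h2 : ∀ t, i (σ t) = i' (σ t) ∧ a t = a' t := fun t => (toAVec_inj.1
    ((wires_toA_self (σ, i, o, a) t).symm.trans ((congrFun h (.toA t (σ t))).trans
      (wires_toA_self (σ, i', o', a') t)))).2
  have h3 : ∀ t, o (σ t) = o' (σ t) ∧ a t = a' t := fun t => (fromAVec_inj.1
    ((wires_fromA_self (σ, i, o, a) t).symm.trans ((congrFun h (.fromA t (σ t))).trans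
      (wires_fromA_self (σ, i', o', a') t)))).2
  have hi : i = i' := funext fun k => by
    obtain ⟨t, rfl⟩ := σ.surjective k
    exact (h2 t).1
  have ho : o = o' := funext fun k => by
    obtain ⟨t, rfl⟩ := σ.surjective k
    exact (h3 t).1
  rw [hi, ho, funext fun t => (h2 t).2]

theorem wires_in_A (d : History S) (t : Fin (m + 1)) :
    (fun a : (genericIndexed (m + 1)).In (.A (d.1 t)) => wires p f d a.1) =
      encInA S (d.1 t) (d.2.1 (d.1 t), ⟨t, d.2.2.2 t, visitedSubs d.1 t⟩) :=
  eq_encInA_iff.2 ⟨wires_toA_self d t, fun _ ht' => wires_toA_of_ne (d.1.injective.ne ht')⟩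

theorem wires_out_A (d : History S) (t : Fin (m + 1)) :
    (fun a : (genericIndexed (m + 1)).Out (.A (d.1 t)) => wires p f d a.1) =
      encOutA S (d.1 t) (d.2.2.1 (d.1 t), ⟨t, d.2.2.2 t, visitedSubs d.1 t⟩) :=
  eq_encOutA_iff.2 ⟨wires_fromA_self d t, fun _ ht' => wires_fromA_of_ne (d.1.injective.ne ht')⟩

theorem wires_in_V (d : History S) (t : Fin (m + 1)) :
    (fun a : (genericIndexed (m + 1)).In (.V t.succ) => wires p f d a.1) =
      encInV S t (d.2.2.1 (d.1 t), d.2.2.2 t,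
        ⟨(before d.1 (t + 1), d.1 t), (visitedSubs d.1 t).2⟩) :=
  eq_encInV_iff.2 ⟨wires_fromA_self d t, fun _ hk => wires_fromA_of_ne hk.symm⟩

theorem wires_out_V (d : History S) (t : Fin (m + 1)) :
    (fun a : (genericIndexed (m + 1)).Out (.V t.castSucc) => wires p f d a.1) =
      encOutV S t (d.2.1 (d.1 t), d.2.2.2 t,
        ⟨(before d.1 (t + 1), d.1 t), (visitedSubs d.1 t).2⟩) :=
  eq_encOutV_iff.2 ⟨wires_toA_self d t, fun _ hk => wires_toA_of_ne hk.symm⟩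

theorem wires_in_first (d : History S) :
    (fun a : (genericIndexed (m + 1)).In (.V 0) => wires p f d a.1) = encInFirst S p :=
  eq_encInFirst_iff.2 rfl

theorem wires_out_last (d : History S) :
    (fun a : (genericIndexed (m + 1)).Out (.V (Fin.last (m + 1))) => wires p f d a.1) =
      encOutLast S f :=
  eq_encOutLast_iff.2 rfl

theorem fillA_wires (A : Fin (m + 1) → Matrix S.AO S.AI ℂ) (d : History S) (k : Fin (m + 1)) :
    fillA S k (A k) (fun a => wires p f d a.1) (fun a => wires p f d a.1) =
      A k (d.2.2.1 k) (d.2.1 k) := by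
  obtain ⟨t, rfl⟩ := d.1.surjective k
  refine (congrArg₂ (fillA S (d.1 t) (A (d.1 t))) (wires_out_A d t) (wires_in_A d t)).trans ?_
  rw [(isCorner_fillA _ _).apply_eq, Matrix.kronecker_apply, Matrix.one_apply_eq, mul_one]

theorem fillV_wires_zero (Q : QCQC S) (d : History S) :
    fillV Q 0 (fun a => wires p f d a.1) (fun a => wires p f d a.1) =
      Q.first (d.1 0) (d.2.1 (d.1 0), d.2.2.2 0) p := by
  refine (congrArg₂ (fillV Q 0) (wires_out_V d 0) (wires_in_first d)).trans ?_
  exact (isCorner_fillV_zero Q).apply_eq _ _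

theorem fillV_wires_mid (Q : QCQC S) (d : History S) (s : Fin m) :
    fillV Q s.castSucc.succ (fun a => wires p f d a.1) (fun a => wires p f d a.1) =
      Q.mid s (QCQC.visited d.1 s.castSucc) (d.1 s.castSucc) (d.1 s.succ)
        (d.2.1 (d.1 s.succ), d.2.2.2 s.succ) (d.2.2.1 (d.1 s.castSucc), d.2.2.2 s.castSucc) := by
  refine (congrArg₂ (fillV Q s.castSucc.succ) (wires_out_V d s.succ)
    (wires_in_V d s.castSucc)).trans ?_
  refine ((isCorner_fillV_succ_castSucc Q s).apply_eq _ _).trans ?_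
  rw [visited_eq_before]
  exact if_pos (before_succ d.1 s.succ)

theorem fillV_wires_last (Q : QCQC S) (d : History S) :
    fillV Q (Fin.last m).succ (fun a => wires p f d a.1) (fun a => wires p f d a.1) =
      Q.last (d.1 (Fin.last m)) f (d.2.2.1 (d.1 (Fin.last m)), d.2.2.2 (Fin.last m)) := by
  refine (congrArg₂ (fillV Q (Fin.last m).succ) (wires_out_last d)
    (wires_in_V d (Fin.last m))).trans ?_
  exact (isCorner_fillV_last Q).apply_eq _ _

/-- The contribution of a history to the process vector. -/
noncomputable def historyAmplitude (Q : QCQC S) (p : S.P) (f : S.F) (d : History S) : ℂ :=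
  Q.first (d.1 0) (d.2.1 (d.1 0), d.2.2.2 0) p *
    (∏ s : Fin m, Q.mid s (QCQC.visited d.1 s.castSucc) (d.1 s.castSucc) (d.1 s.succ)
      (d.2.1 (d.1 s.succ), d.2.2.2 s.succ) (d.2.2.1 (d.1 s.castSucc), d.2.2.2 s.castSucc)) *
    Q.last (d.1 (Fin.last m)) f (d.2.2.1 (d.1 (Fin.last m)), d.2.2.2 (Fin.last m))

/-- The product of the entries of the filled nodes at given basis vectors of all the wires. -/
noncomputable def nodeProduct (Q : QCQC S) (A : Fin (m + 1) → Matrix S.AO S.AI ℂ)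
    (x : ∀ a : QArr (m + 1), (dims S).Wire a) : ℂ :=
  (∏ k, fillA S k (A k) (fun a => x a.1) (fun a => x a.1)) *
    ∏ j, fillV Q j (fun a => x a.1) (fun a => x a.1)

theorem nodeProduct_wires (Q : QCQC S) (A : Fin (m + 1) → Matrix S.AO S.AI ℂ) (d : History S) :
    nodeProduct Q A (wires p f d) =
      (∏ k, A k (d.2.2.1 k) (d.2.1 k)) * historyAmplitude Q p f d := by
  refine congrArg₂ (· * ·) (Finset.prod_congr rfl fun k _ => fillA_wires A d k) ?_
  refine (Fin.prod_univ_succ _).trans ?_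
  rw [Fin.prod_univ_castSucc (n := m), ← mul_assoc]
  exact congrArg₂ (· * ·) (congrArg₂ (· * ·) (fillV_wires_zero Q d)
    (Finset.prod_congr rfl fun s _ => fillV_wires_mid Q d s)) (fillV_wires_last Q d)

/-- A nonzero term of the contraction comes from a history: the routes force the index values to
be those of an order of the agents, and the node of each agent transmits the ancilla. -/
theorem exists_history (Q : QCQC S) (A : Fin (m + 1) → Matrix S.AO S.AI ℂ)
    {x : ∀ a : QArr (m + 1), (dims S).Wire a} (hp : x .past = pastVec p)
    (hf : x .future = futureVec f) (hx : nodeProduct Q A x ≠ 0) : ∃ d, wires p f d = x := by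
  have hA : ∀ k, fillA S k (A k) (fun a => x a.1) (fun a => x a.1) ≠ 0 := fun k =>
    Finset.prod_ne_zero_iff.1 (left_ne_zero_of_mul hx) k (Finset.mem_univ k)
  have hV : ∀ j, fillV Q j (fun a => x a.1) (fun a => x a.1) ≠ 0 := fun j =>
    Finset.prod_ne_zero_iff.1 (right_ne_zero_of_mul hx) j (Finset.mem_univ j)
  have hcons : IsConsistent fun a => (x a).1 := by
    intro n
    by_contra hr
    cases n with
    | A k => exact hA k (follows_fillA k (A k) _ _ hr)
    | V j => exact hV j ((isRoutedIsometry_fillV Q j).1 _ _ hr)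
  obtain ⟨σ, hσ⟩ := hcons.exists_eq_assign
  have hto : ∀ t k : Fin (m + 1), (x (.toA t k)).1 = slotValue σ t k := fun t k =>
    congrFun hσ (.toA t k)
  have hfrom : ∀ t k : Fin (m + 1), (x (.fromA t k)).1 = slotValue σ t k := fun t k =>
    congrFun hσ (.fromA t k)
  have hnode : ∀ t, ∃ i o a, x (.toA t (σ t)) = toAVec (visitedSubs σ t) i a ∧
      x (.fromA t (σ t)) = fromAVec (visitedSubs σ t) o a := by
    intro t
    obtain ⟨w, z, hw, hz⟩ := (isCorner_fillA _ _).exists_of_ne_zero _ _ (hA (σ t))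
    have hne := hA (σ t)
    rw [hw, hz, (isCorner_fillA _ _).apply_eq] at hne
    have hwz : w.2 = z.2 := by
      by_contra h
      rw [Matrix.kronecker_apply, Matrix.one_apply_ne h, mul_zero] at hne
      exact hne rfl
    obtain ⟨o, c⟩ := w
    obtain ⟨i, t', a, K⟩ := z
    dsimp only at hwz
    subst hwz
    have h1 : x (.toA t' (σ t)) = toAVec K i a := (eq_encInA_iff.1 hz).1
    have h2 : x (.fromA t' (σ t)) = fromAVec K o a := (eq_encOutA_iff.1 hw).1
    have h3 : slotValue σ t' (σ t) = some K := (hto t' (σ t)).symm.trans (congrArg Sigma.fst h1)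
    obtain rfl : t' = t := by
      by_contra h
      rw [slotValue_of_ne (σ.injective.ne h)] at h3
      exact Option.some_ne_none _ h3.symm
    rw [slotValue_self, Option.some.injEq] at h3
    subst h3
    exact ⟨i, o, a, h1, h2⟩
  choose i o a hi ho using hnode
  refine ⟨(σ, fun k => i (σ.symm k), fun k => o (σ.symm k), a), funext fun b => ?_⟩
  cases b with
  | past => exact hp.symm
  | future => exact hf.symm
  | toA t k =>
    by_cases hk : σ t = k
    · subst hk
      refine (wires_toA_self _ t).trans ((hi t).trans ?_).symm
      simp
    · refine (wires_toA_of_ne hk).trans (eq_toANull ?_).symm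
      exact (hto t k).trans (slotValue_of_ne hk)
  | fromA t k =>
    by_cases hk : σ t = k
    · subst hk
      refine (wires_fromA_self _ t).trans ((ho t).trans ?_).symm
      simp
    · refine (wires_fromA_of_ne hk).trans (eq_fromANull ?_).symm
      exact (hfrom t k).trans (slotValue_of_ne hk)

open Classical in
theorem fleshedOut_apply (Q : QCQC S) (A : Fin (m + 1) → Matrix S.AO S.AI ℂ) (f : S.F) (p : S.P) :
    fleshedOut Q A f p = ∑ x : ∀ a : (generic (m + 1)).toIndexedGraph.Arr, (dims S).Wire a,
      if x .past = pastVec p ∧ x .future = futureVec f then nodeProduct Q A x else 0 := by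
  refine Finset.sum_congr rfl fun x _ => ?_
  refine if_congr (and_congr ⟨fun h => h ⟨.past, rfl⟩, ?_⟩ ⟨fun h => h ⟨.future, rfl⟩, ?_⟩)
    (prod_qNode _) rfl
  · rintro h ⟨b, hb⟩
    cases b with
    | past => exact h
    | future => cases hb
    | toA => cases hb
    | fromA => cases hb
  · rintro h ⟨b, hb⟩
    cases b with
    | past => cases hb
    | future => exact h
    | toA => cases hb
    | fromA => cases hb

/-- The contraction along the arrows is a sum over histories. The ancillary basis vector at each
time slot occurs only once, since the agent's node transmits it unchanged. -/
theorem fleshedOut_eq_sum_history (Q : QCQC S) (A : Fin (m + 1) → Matrix S.AO S.AI ℂ) (f : S.F)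
    (p : S.P) : fleshedOut Q A f p =
      ∑ d : History S, (∏ k, A k (d.2.2.1 k) (d.2.1 k)) * historyAmplitude Q p f d := by
  classical
  rw [fleshedOut_apply]
  symm
  refine Fintype.sum_of_injective
    (κ := ∀ a : (generic (m + 1)).toIndexedGraph.Arr, (dims S).Wire a) (wires p f)
    wires_injective _ _ (fun x hx => ?_) (fun d => ?_)
  · split_ifs with h
    · by_contra hne
      exact hx (exists_history Q A h.1 h.2 hne)
    · rfl
  · exact (nodeProduct_wires Q A d).symm.trans (if_pos ⟨rfl, rfl⟩).symm

theorem processVector_eq_sum (Q : QCQC S) (p : S.P) (i : Fin (m + 1) → S.AI)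
    (o : Fin (m + 1) → S.AO) (f : S.F) : Q.processVector p i o f =
      ∑ σ : Equiv.Perm (Fin (m + 1)), ∑ a : ∀ t, S.α t, historyAmplitude Q p f (σ, i, o, a) :=
  rfl

theorem fleshedOut_eq_supermap (Q : QCQC S) : fleshedOut Q = Q.supermap := by
  funext A f p
  rw [fleshedOut_eq_sum_history, QCQC.supermap, Fintype.sum_prod_type]
  simp only [Fintype.sum_prod_type, processVector_eq_sum, Finset.mul_sum]
  rw [Finset.sum_comm]
  refine Finset.sum_congr rfl fun i _ => ?_
  rw [Finset.sum_comm]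

theorem processVectorOf_supermap (Q : QCQC S) : processVectorOf Q.supermap = Q.processVector := by
  funext p i o f
  rw [processVectorOf, QCQC.supermap, Finset.sum_eq_single i, Finset.sum_eq_single o]
  · simp
  · intro o' _ ho
    obtain ⟨k, hk⟩ := Function.ne_iff.1 ho
    rw [Finset.prod_eq_zero (Finset.mem_univ k), zero_mul]
    simp [Matrix.single, hk.symm]
  · simp
  · intro i' _ hi
    obtain ⟨k, hk⟩ := Function.ne_iff.1 hi
    refine Finset.sum_eq_zero fun o' _ => ?_
    rw [Finset.prod_eq_zero (Finset.mem_univ k), zero_mul]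
    simp [Matrix.single, hk.symm]
  · simp

end Contraction

/-! ### Completely positive maps of the agents -/

section Discarding

variable {m : ℕ} {S : Spaces m}

/-- With `r` the Kraus indices, `a` the discarded system, and `j`, `j'` the basis vectors of the
agents' systems, this turns the Choi matrix of the resulting map into a link product. -/
theorem sum_sum_mul_sum {α β γ : Type} [Fintype α] [Fintype β] [Fintype γ] (u v : α → γ → ℂ)
    (w z : β → γ → ℂ) :
    ∑ r, ∑ a, (∑ j, u r j * w a j) * (∑ j', v r j' * z a j') =
      ∑ j, ∑ j', (∑ r, u r j * v r j') * ∑ a, w a j * z a j' := by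
  simp only [Finset.sum_mul_sum, ← Fintype.sum_prod_type']
  refine Fintype.sum_equiv
    { toFun := fun x => (x.2.2.1, x.2.2.2, x.1, x.2.1)
      invFun := fun x => (x.2.2.1, x.2.2.2, x.1, x.2.1)
      left_inv := fun _ => rfl
      right_inv := fun _ => rfl } _ _ fun x => ?_
  exact mul_mul_mul_comm _ _ _ _

theorem choiMatrix_discardKraus_supermap (Q : QCQC S) {F' αF : Type} [Fintype αF]
    (e : S.F ≃ F' × αF) (R : Fin (m + 1) → Type) [∀ k, Fintype (R k)]
    (A : ∀ k, R k → Matrix S.AO S.AI ℂ) :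
    choiMatrix (discardKraus e Q.supermap A) =
      mixedSupermap (mixedProcessMatrix e Q.processVector) (fun k => choiMatrix (A k)) := by
  have hT : ∀ (r : ∀ k, R k) (f : S.F) (p : S.P), Q.supermap (fun k => A k (r k)) f p =
      ∑ j : (Fin (m + 1) → S.AI) × (Fin (m + 1) → S.AO),
        (∏ k, A k (r k) (j.2 k) (j.1 k)) * Q.processVector p j.1 j.2 f := fun r f p =>
    (Fintype.sum_prod_type' fun (i : Fin (m + 1) → S.AI) (o : Fin (m + 1) → S.AO) =>
      (∏ k, A k (r k) (o k) (i k)) * Q.processVector p i o f).symm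
  have hM : ∀ j j' : (Fin (m + 1) → S.AI) × (Fin (m + 1) → S.AO),
      ∏ k, choiMatrix (A k) (j.1 k, j.2 k) (j'.1 k, j'.2 k) =
        ∑ r : ∀ k, R k, (∏ k, A k (r k) (j.2 k) (j.1 k)) *
          star (∏ k, A k (r k) (j'.2 k) (j'.1 k)) := by
    intro j j'
    simp only [choiMatrix, Finset.prod_univ_sum, Fintype.piFinset_univ, star_prod,
      Finset.prod_mul_distrib]
  ext x y
  have hR : mixedSupermap (mixedProcessMatrix e Q.processVector) (fun k => choiMatrix (A k)) x y =
      ∑ j : (Fin (m + 1) → S.AI) × (Fin (m + 1) → S.AO),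
        ∑ j' : (Fin (m + 1) → S.AI) × (Fin (m + 1) → S.AO),
          (∏ k, choiMatrix (A k) (j.1 k, j.2 k) (j'.1 k, j'.2 k)) *
            ∑ a, Q.processVector x.1 j.1 j.2 (e.symm (x.2, a)) *
              star (Q.processVector y.1 j'.1 j'.2 (e.symm (y.2, a))) := by
    simp only [Fintype.sum_prod_type]
    rfl
  have hL : choiMatrix (discardKraus e Q.supermap A) x y = ∑ r : ∀ k, R k, ∑ a,
      (∑ j : (Fin (m + 1) → S.AI) × (Fin (m + 1) → S.AO),
        (∏ k, A k (r k) (j.2 k) (j.1 k)) * Q.processVector x.1 j.1 j.2 (e.symm (x.2, a))) *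
      (∑ j : (Fin (m + 1) → S.AI) × (Fin (m + 1) → S.AO),
        star (∏ k, A k (r k) (j.2 k) (j.1 k)) *
          star (Q.processVector y.1 j.1 j.2 (e.symm (y.2, a)))) := by
    refine (Fintype.sum_prod_type _).trans ?_
    refine Finset.sum_congr rfl fun r _ => Finset.sum_congr rfl fun a _ => ?_
    refine congrArg₂ (· * ·) (hT r _ _) ((congrArg star (hT r _ _)).trans ?_)
    rw [star_sum]
    exact Finset.sum_congr rfl fun j _ => star_mul' _ _
  rw [hR, hL, sum_sum_mul_sum]
  exact Finset.sum_congr rfl fun j _ => Finset.sum_congr rfl fun j' _ =>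
    congrArg (· * _) (hM j j').symm

end Discarding

end RQC

theorem theorem4p1 (m : ℕ) :
    ((generic (m + 1)).BiUnivocal ∧
      IsEmpty ((generic (m + 1)).Loop (nullOneDim (m + 1))) ∧
      (generic (m + 1)).Valid (nullOneDim (m + 1))) ∧
    ∀ S : Spaces m,
      (∀ a, ∀ k ∈ nullOneDim (m + 1) a, (dims S).dim a k = 1) ∧
      (∀ k : Fin (m + 1),
        IsRoutedSuperunitary (genericRoute (m + 1) (.A k)) ((dims S).inSector (.A k))
          ((dims S).outSector (.A k)) (fun A : Unit → Matrix S.AO S.AI ℂ => fillA S k (A ()))) ∧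
      ∀ Q : QCQC S,
        (∀ j : Fin (m + 2),
          IsRoutedIsometry (genericRoute (m + 1) (.V j)) ((dims S).inSector (.V j))
            ((dims S).outSector (.V j)) (fillV Q j)) ∧
        IsFleshingOut (G := generic (m + 1)) (filling Q) ∧
        fleshedOut Q = Q.supermap ∧
        processVectorOf (fleshedOut Q) = Q.processVector ∧
        ∀ (F' αF : Type) [Fintype F'] [Fintype αF] (e : S.F ≃ F' × αF),
          mixedProcessMatrix e (processVectorOf (fleshedOut Q)) =
            mixedProcessMatrix e Q.processVector ∧
          ∀ (R : Fin (m + 1) → Type) [∀ k, Fintype (R k)] (A : ∀ k, R k → Matrix S.AO S.AI ℂ),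
            choiMatrix (discardKraus e (fleshedOut Q) A) =
              mixedSupermap (mixedProcessMatrix e Q.processVector)
                (fun k => choiMatrix (A k)) := by
  refine ⟨⟨valid_generic.1, isEmpty_loop_generic, valid_generic⟩, fun S => ⟨?_, ?_, ?_⟩⟩
  · intro a k hk
    cases a with
    | past => exact absurd hk (Set.notMem_empty k)
    | future => exact absurd hk (Set.notMem_empty k)
    | toA t l =>
      obtain rfl : k = (none : Option (QArr.Subs t l)) := hk
      exact Fintype.card_unit
    | fromA t l =>
      obtain rfl : k = (none : Option (QArr.Subs t l)) := hk
      exact Fintype.card_unit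
  · exact isRoutedSuperunitary_fillA
  · intro Q
    rw [fleshedOut_eq_supermap, processVectorOf_supermap]
    exact ⟨isRoutedIsometry_fillV Q, isFleshingOut_filling Q, rfl, rfl, fun F' αF _ _ e =>
      ⟨rfl, fun R _ A => choiMatrix_discardKraus_supermap Q e R A⟩⟩
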